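/- Let $G$ be a countable discrete amenable group, i.e. there are non-empty finite sets $F_n\subset G$ ($n\in\mathbb N$) with $|gF_n\,\Delta\, F_n|/|F_n|\to 0$ for every $g\in G$ (a Følner sequence). Let $G$ act by continuous automorphisms on a compact metric group $X$ (a compact topological group with a compatible metric $\rho$). Let $\Sigma=\{\sigma_i:G\to \mathrm{Sym}(d_i)\}_{i\in\mathbb N}$ be a sofic approximation of $G$, i.e. $d_i\ge 1$, $d_i\to\infty$, $\frac1{d_i}|\{a:\sigma_{i,s}\sigma_{i,t}(a)=\sigma_{i,st}(a)\}|\to 1$ for all $s,t\in G$, and $\frac1{d_i}|\{a:\sigma_{i,s}(a)\ne\sigma_{i,t}(a)\}|\to1$ for all distinct $s,t\in G$. Notation: $\log 0=-\infty$; $\mathcal C_X^o$ is the set of finite open covers of $X$; $N(\mathcal V,K)$ is the least cardinality of a subfamily of $\mathcal V$ covering $K$ (so $N(\mathcal V,\emptyset)=0$); $\mathcal U^d=\{U_1\times\dots\times U_d: U_j\in\mathcal U\}$; and $\mathcal U_F=\bigvee_{g\in F}g^{-1}\mathcal U$. For non-empty finite $F\subset G$, $\delta>0$ and $\sigma:G\to\mathrm{Sym}(d)$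 put $$X^d_{F,\delta,\sigma}=\Big\{(x_1,\dots,x_d)\in X^d:\max_{s\in F}\Big(\tfrac1d\sum_{j=1}^d\rho(sx_j,x_{\sigma_s(j)})^2\Big)^{1/2}<\delta\Big\}.$$ The action is called asymptotically $h$-expansive (with respect to $\Sigma$) if $$\inf_{\mathcal U_2\in\mathcal C_X^o}\ \sup_{\mathcal U_1\in\mathcal C_X^o}\ \inf_{F}\ \inf_{\delta>0}\ \limsup_{i\to\infty}\frac1{d_i}\log\max_{V\in\mathcal U_2^{d_i}}N\big(\mathcal U_1^{d_i},X^{d_i}_{F,\delta,\sigma_i}\cap V\big)\le 0 .$$ The topological entropy of the action is $$h^a(G,X)=\sup_{\mathcal U\in\mathcal C_X^o}\ \lim_{n\to\infty}\frac1{|F_n|}\log N(\mathcal U_{F_n},X),$$ where, by the Ornstein–Weiss lemma, the limits exist and do not depend on the Følner sequence. Then the action of $G$ on $X$ is asymptotically $h$-expansive if and only if $h^a(G,X)<\infty$. -/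

import Mathlib

open Filter Topology

noncomputable section

namespace AlgAction

/-- A sofic approximation of `G`: maps `σ i : G → Sym(d i)`, `d i ≥ 1`, `d i → ∞`, that are
asymptotically multiplicative and asymptotically free. -/
structure SoficApproximation (G : Type*) [Group G] where
  d : ℕ → ℕ
  d_pos : ∀ i, 0 < d i
  tendsto_d : Tendsto d atTop atTop
  σ : ∀ i, G → Equiv.Perm (Fin (d i))
  tendsto_mul : ∀ s t : G, Tendsto
    (fun i => ((Finset.univ.filter fun a : Fin (d i) =>
      σ i s (σ i t a) = σ i (s * t) a).card : ℝ) / (d i : ℝ)) atTop (𝓝 1)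
  tendsto_free : ∀ s t : G, s ≠ t → Tendsto
    (fun i => ((Finset.univ.filter fun a : Fin (d i) =>
      σ i s a ≠ σ i t a).card : ℝ) / (d i : ℝ)) atTop (𝓝 1)

open Classical in
/-- A (left) Følner sequence of nonempty finite subsets of `G`; `G` is amenable iff one exists. -/
structure IsFolnerSequence {G : Type*} [Group G] (F : ℕ → Finset G) : Prop where
  nonempty : ∀ n, (F n).Nonempty
  tendsto_symmDiff : ∀ g : G, Tendsto
    (fun n => ((symmDiff ((F n).image fun x => g * x) (F n)).card : ℝ) / ((F n).card : ℝ))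
    atTop (𝓝 0)

/-- Finite open covers of a space. -/
structure IsFiniteOpenCover {X : Type*} [TopologicalSpace X] (U : Set (Set X)) : Prop where
  finite : U.Finite
  isOpen : ∀ u ∈ U, IsOpen u
  sUnion_eq : ⋃₀ U = Set.univ

/-- `N(𝒱, K)`: the least cardinality of a subfamily of `V` covering `K` (so `N(𝒱, ∅) = 0`). -/
def coverNumber {Y : Type*} (V : Set (Set Y)) (K : Set Y) : ℕ∞ :=
  ⨅ (S : Set (Set Y)) (_ : S ⊆ V) (_ : K ⊆ ⋃₀ S), S.encard

/-- `log N(𝒱, K)` and the like, with `log 0 = -∞`. -/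
def logCard (n : ℕ∞) : EReal := ENNReal.log (n : ENNReal)

/-! ### Sofic side -/

/-- `𝒰^d`: the cover of `X^d` by products `U₁ × ⋯ × U_d` with all `U_j ∈ 𝒰`. -/
def powerCover {X : Type*} (U : Set (Set X)) (d : ℕ) : Set (Set (Fin d → X)) :=
  {W | ∃ u : Fin d → Set X, (∀ j, u j ∈ U) ∧ W = Set.pi Set.univ u}

/-- The set `X^d_{F,δ,σ}` of `δ`-approximately equivariant points of `X^d`. -/
def almostEquivariant {G X : Type*} [Group G] [MetricSpace X] [MulAction G X] {d : ℕ}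
    (F : Finset G) (δ : ℝ) (σ : G → Equiv.Perm (Fin d)) : Set (Fin d → X) :=
  {x | ∀ s ∈ F, Real.sqrt (∑ j, (1 / (d : ℝ)) * dist (s • x j) (x (σ s j)) ^ 2) < δ}

/-- `h_{F,δ}(G, 𝒰₁ | 𝒰₂)`. -/
def soficCondEntropyAt {G X : Type*} [Group G] [MetricSpace X] [MulAction G X]
    (S : SoficApproximation G) (F : Finset G) (δ : ℝ) (U₁ U₂ : Set (Set X)) : EReal :=
  limsup (fun i => logCard (⨆ V ∈ powerCover U₂ (S.d i),
    coverNumber (powerCover U₁ (S.d i)) (almostEquivariant F δ (S.σ i) ∩ V)) /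
      ((S.d i : ℝ) : EReal)) atTop

/-- `h(G, 𝒰₁ | 𝒰₂)`. -/
def soficCondEntropy {G X : Type*} [Group G] [MetricSpace X] [MulAction G X]
    (S : SoficApproximation G) (U₁ U₂ : Set (Set X)) : EReal :=
  ⨅ (F : Finset G) (_ : F.Nonempty) (δ : ℝ) (_ : 0 < δ), soficCondEntropyAt S F δ U₁ U₂

/-- `h(G, X | 𝒰₂)`. -/
def soficEntropyGiven {G X : Type*} [Group G] [MetricSpace X] [MulAction G X]
    (S : SoficApproximation G) (U₂ : Set (Set X)) : EReal :=
  ⨆ (U₁ : Set (Set X)) (_ : IsFiniteOpenCover U₁), soficCondEntropy S U₁ U₂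

/-- `h^*(G, X)`. -/
def soficTailEntropy {G : Type*} [Group G] (S : SoficApproximation G)
    (X : Type*) [MetricSpace X] [MulAction G X] : EReal :=
  ⨅ (U₂ : Set (Set X)) (_ : IsFiniteOpenCover U₂), soficEntropyGiven S U₂

/-- The action of `G` on `X` is asymptotically `h`-expansive (with respect to `S`). -/
def IsAsymptoticallyHExpansive {G : Type*} [Group G] (S : SoficApproximation G)
    (X : Type*) [MetricSpace X] [MulAction G X] : Prop :=
  soficTailEntropy S X ≤ 0

/-! ### Amenable side -/

/-- `𝒲_F = ⋁_{g ∈ F} g⁻¹ 𝒲`. -/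
def joinCover {G X : Type*} [Group G] [MulAction G X] (W : Set (Set X)) (F : Finset G) :
    Set (Set X) :=
  {K | ∃ w : G → Set X, (∀ g ∈ F, w g ∈ W) ∧ K = ⋂ g ∈ F, (fun x : X => g • x) ⁻¹' w g}

/-- `m_{𝒲₁,𝒲₂}(F) = max_{K ∈ (𝒲₂)_F} log N((𝒲₁)_F, K)`. -/
def condLogCover {G X : Type*} [Group G] [MulAction G X] (W₁ W₂ : Set (Set X))
    (F : Finset G) : EReal :=
  ⨆ K ∈ joinCover W₂ F, logCard (coverNumber (joinCover W₁ F) K)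

/-- `h^a(G, 𝒲₁ | 𝒲₂)`, computed along the Følner sequence `F`. By the Ornstein-Weiss lemma the
`limsup` is a limit and does not depend on the Følner sequence. -/
def amenableCondEntropy {G X : Type*} [Group G] [MulAction G X] (F : ℕ → Finset G)
    (W₁ W₂ : Set (Set X)) : EReal :=
  limsup (fun n => condLogCover W₁ W₂ (F n) / (((F n).card : ℝ) : EReal)) atTop

/-- `h^a(G, X | 𝒲₂)`. -/
def amenableEntropyGiven {G X : Type*} [Group G] [TopologicalSpace X] [MulAction G X]
    (F : ℕ → Finset G) (W₂ : Set (Set X)) : EReal :=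
  ⨆ (U : Set (Set X)) (_ : IsFiniteOpenCover U), amenableCondEntropy F U W₂

/-- The topological entropy `h^a(G, X) = h^a(G, X | {X})`. -/
def amenableTopEntropy {G : Type*} [Group G] (F : ℕ → Finset G)
    (X : Type*) [TopologicalSpace X] [MulAction G X] : EReal :=
  amenableEntropyGiven F ({Set.univ} : Set (Set X))

end AlgAction

end

/-! Both implications compare entropy with the exponential growth rate of separated sets of almost
equivariant points in `X^d`. Separation is measured by neighbourhoods `P` of the identity: some
coordinate has `(x j)⁻¹ * y j ∉ P`. Ornstein–Weiss quasi-tilings split nearly all of `Fin d` into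
disjoint, almost complete translates of Følner sets. Gluing orbit pieces along the tiles turns
separated orbits into separated almost equivariant points (`eventually_exists_separated`).
Conversely, an almost equivariant point is determined, up to `P` and a few exceptional coordinates,
by its values at the tile centers (`eventually_card_separated_le`). So the growth rate tends to
`h^a(G, X)` as `P` shrinks.

If the action is asymptotically `h`-expansive, some finite cover `U₂` has conditional entropy below
1. Since `X^d` is covered by at most `|U₂|^d` boxes, this gives `h^a(G, X) ≤ log |U₂| + 2`.

If `h^a(G, X) = e` is finite, some fixed scale `O` already carries entropy close to `e`. Let `E` be
`O`-separated with about `exp(e d)` points, and let `Q` be a finely separated set inside one box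
that is small compared with `O`. By homogeneity of the group, the products `x * y₀⁻¹ * y` with `x ∈
E`, `y ∈ Q` are finely separated and still almost equivariant, so there are at most about `exp(e d)`
of them (`card_mul_card_le`). Hence `Q` has subexponential size up to an arbitrarily small rate.
Finiteness of `e` is what permits the division. -/

namespace AlgAction

/-! ### Quasi-tilings of sofic approximations -/

section QuasiTiling

open Classical in
/-- The points at which `σ` is multiplicative and free as far as `L` can see. -/
noncomputable def goodSet {G : Type*} [Group G] {d : ℕ} (σ : G → Equiv.Perm (Fin d)) (L : Finset G) :
    Finset (Fin d) :=
  Finset.univ.filter fun c => (∀ s ∈ L, ∀ t ∈ L, σ s (σ t c) = σ (s * t) c) ∧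
    ∀ s ∈ L, ∀ t ∈ L, σ s c = σ t c → s = t

/-- A tile: the translate `σ(part) center` of a part of the shape `F shape`. -/
structure Tile (G : Type*) (d : ℕ) where
  center : Fin d
  shape : ℕ
  part : Finset G

open Classical in
/-- The points covered by a tile. -/
noncomputable def Tile.points {G : Type*} {d : ℕ} (σ : G → Equiv.Perm (Fin d)) (τ : Tile G d) :
    Finset (Fin d) :=
  τ.part.image fun t => σ t τ.center

open Classical in
/-- The points covered by a family of tiles. -/
noncomputable def region {G : Type*} {d : ℕ} (σ : G → Equiv.Perm (Fin d)) (𝒯 : Finset (Tile G d)) :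
    Finset (Fin d) :=
  𝒯.biUnion (Tile.points σ)

theorem mem_region {G : Type*} {d : ℕ} {σ : G → Equiv.Perm (Fin d)} {𝒯 : Finset (Tile G d)}
    {j : Fin d} : j ∈ region σ 𝒯 ↔ ∃ τ ∈ 𝒯, ∃ t ∈ τ.part, σ t τ.center = j := by
  simp [region, Tile.points]

/-- Families of pairwise disjoint tiles, each of which is a `(1 - ε)`-fraction of a shape whose
translate is covered by the whole family. -/
structure IsTiling {G : Type*} [Group G] {d : ℕ} (σ : G → Equiv.Perm (Fin d))
    (F : ℕ → Finset G) (L : Finset G) (ε : ℝ) (N : Finset ℕ) (𝒯 : Finset (Tile G d)) : Prop where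
  good : ∀ τ ∈ 𝒯, τ.center ∈ goodSet σ L
  shape_mem : ∀ τ ∈ 𝒯, τ.shape ∈ N
  part_subset : ∀ τ ∈ 𝒯, τ.part ⊆ F τ.shape
  le_card : ∀ τ ∈ 𝒯, (1 - ε) * (F τ.shape).card ≤ τ.part.card
  disjoint : ∀ τ ∈ 𝒯, ∀ τ' ∈ 𝒯, τ ≠ τ' → Disjoint (τ.points σ) (τ'.points σ)
  full : ∀ τ ∈ 𝒯, ∀ f ∈ F τ.shape, σ f τ.center ∈ region σ 𝒯

variable {G : Type*} [Group G] {d : ℕ} {σ : G → Equiv.Perm (Fin d)} {F : ℕ → Finset G}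
  {L : Finset G} {ε : ℝ} {N : Finset ℕ} {𝒯 : Finset (Tile G d)}

theorem mem_goodSet {c : Fin d} : c ∈ goodSet σ L ↔
    (∀ s ∈ L, ∀ t ∈ L, σ s (σ t c) = σ (s * t) c) ∧
    ∀ s ∈ L, ∀ t ∈ L, σ s c = σ t c → s = t := by
  simp [goodSet]

theorem eventually_goodSet (S : SoficApproximation G) (L : Finset G) {γ : ℝ} (hγ : 0 < γ) :
    ∀ᶠ i in atTop, (1 - γ) * (S.d i : ℝ) ≤ (goodSet (S.σ i) L).card := by
  classical
  have compl : ∀ (p : ∀ i, Fin (S.d i) → Prop) [∀ i, DecidablePred (p i)],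
      Tendsto (fun i => ((Finset.univ.filter (p i)).card : ℝ) / (S.d i : ℝ)) atTop (𝓝 1) →
      Tendsto (fun i => ((Finset.univ.filter fun a => ¬ p i a).card : ℝ) / (S.d i : ℝ))
        atTop (𝓝 0) := by
    intro p _ hp
    have := hp.const_sub 1
    rw [sub_self] at this
    refine this.congr fun i => ?_
    have hd : (S.d i : ℝ) ≠ 0 := by exact_mod_cast (S.d_pos i).ne'
    have := Finset.card_filter_add_card_filter_not (s := (Finset.univ : Finset (Fin (S.d i)))) (p i)
    rw [Finset.card_univ, Fintype.card_fin] at this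
    have h2 : ((Finset.univ.filter (p i)).card : ℝ) +
      (Finset.univ.filter fun a => ¬ p i a).card = S.d i := by exact_mod_cast this
    field_simp
    linarith
  have h1 : Tendsto (fun i => ∑ q ∈ L ×ˢ L,
      (((Finset.univ.filter fun a : Fin (S.d i) =>
        ¬ S.σ i q.1 (S.σ i q.2 a) = S.σ i (q.1 * q.2) a).card : ℝ) / (S.d i : ℝ)
      + ((Finset.univ.filter fun a : Fin (S.d i) =>
        ¬ (S.σ i q.1 a = S.σ i q.2 a → q.1 = q.2)).card : ℝ) / (S.d i : ℝ))) atTop (𝓝 0) := by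
    have h2 : ∀ q : G × G, Tendsto (fun i => ((Finset.univ.filter fun a : Fin (S.d i) =>
        ¬ (S.σ i q.1 a = S.σ i q.2 a → q.1 = q.2)).card : ℝ) / (S.d i : ℝ)) atTop (𝓝 0) := by
      intro q
      by_cases hq : q.1 = q.2
      · simp [hq]
      · have := compl (fun i a => S.σ i q.1 a ≠ S.σ i q.2 a) (S.tendsto_free q.1 q.2 hq)
        simpa [hq] using this
    have h3 := tendsto_finsetSum (L ×ˢ L) fun q _ =>
      (compl (fun i a => S.σ i q.1 (S.σ i q.2 a) = S.σ i (q.1 * q.2) a)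
        (S.tendsto_mul q.1 q.2)).add (h2 q)
    simpa only [add_zero, Finset.sum_const_zero] using h3
  filter_upwards [h1.eventually_lt_const hγ] with i hi
  have hd : (0 : ℝ) < S.d i := by exact_mod_cast S.d_pos i
  have h2 : ((goodSet (S.σ i) L)ᶜ).card ≤ ∑ q ∈ L ×ˢ L,
      ((Finset.univ.filter fun a : Fin (S.d i) =>
        ¬ S.σ i q.1 (S.σ i q.2 a) = S.σ i (q.1 * q.2) a).card
      + (Finset.univ.filter fun a : Fin (S.d i) =>
        ¬ (S.σ i q.1 a = S.σ i q.2 a → q.1 = q.2)).card) := by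
    refine le_trans (Finset.card_le_card (t := (L ×ˢ L).biUnion fun q =>
      (Finset.univ.filter fun a : Fin (S.d i) =>
        ¬ S.σ i q.1 (S.σ i q.2 a) = S.σ i (q.1 * q.2) a) ∪
      (Finset.univ.filter fun a : Fin (S.d i) =>
        ¬ (S.σ i q.1 a = S.σ i q.2 a → q.1 = q.2))) ?_) ?_
    · intro c hc
      rw [Finset.mem_compl, mem_goodSet, not_and_or] at hc
      simp only [Finset.mem_biUnion, Finset.mem_product, Finset.mem_union, Finset.mem_filter,
        Finset.mem_univ, true_and, Prod.exists]
      rcases hc with hc | hc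
      · push Not at hc
        obtain ⟨s, hs, t, ht, h⟩ := hc
        exact ⟨s, t, ⟨hs, ht⟩, Or.inl h⟩
      · push Not at hc
        obtain ⟨s, hs, t, ht, h⟩ := hc
        exact ⟨s, t, ⟨hs, ht⟩, Or.inr (by simpa using h)⟩
    · exact Finset.card_biUnion_le.trans (Finset.sum_le_sum fun q _ => Finset.card_union_le _ _)
  have h3 : (((goodSet (S.σ i) L)ᶜ).card : ℝ) ≤ γ * S.d i := by
    have h4 : (((goodSet (S.σ i) L)ᶜ).card : ℝ) ≤ _ := Nat.cast_le.mpr h2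
    push_cast at h4
    simp_rw [← add_div] at hi
    rw [← Finset.sum_div, div_lt_iff₀ hd] at hi
    exact h4.trans hi.le
  have h5 := Finset.card_add_card_compl (goodSet (S.σ i) L)
  rw [Fintype.card_fin] at h5
  have h6 : ((goodSet (S.σ i) L).card : ℝ) + ((goodSet (S.σ i) L)ᶜ).card = S.d i := by
    exact_mod_cast h5
  linarith

theorem card_points {τ : Tile G d} (hL : F τ.shape ⊆ L) (hsub : τ.part ⊆ F τ.shape)
    (hgood : τ.center ∈ goodSet σ L) : (τ.points σ).card = τ.part.card := by
  classical
  rw [Tile.points, Finset.card_image_of_injOn]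
  intro s hs t ht h
  exact (mem_goodSet.mp hgood).2 s (hL (hsub hs)) t (hL (hsub ht)) h

theorem IsTiling.sum_card_part (h : IsTiling σ F L ε N 𝒯) (hL : ∀ n ∈ N, F n ⊆ L) :
    ∑ τ ∈ 𝒯, τ.part.card = (region σ 𝒯).card := by
  classical
  rw [region, Finset.card_biUnion (fun τ hτ τ' hτ' hne => h.disjoint τ hτ τ' hτ' hne)]
  exact Finset.sum_congr rfl fun τ hτ =>
    (card_points (hL _ (h.shape_mem τ hτ)) (h.part_subset τ hτ) (h.good τ hτ)).symm

theorem IsTiling.sum_card_shape_le (h : IsTiling σ F L ε N 𝒯) (hL : ∀ n ∈ N, F n ⊆ L) :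
    (1 - ε) * ∑ τ ∈ 𝒯, ((F τ.shape).card : ℝ) ≤ d := by
  have h1 : ((region σ 𝒯).card : ℝ) ≤ d := by
    exact_mod_cast (Finset.card_le_univ _).trans (Fintype.card_fin d).le
  rw [← h.sum_card_part hL] at h1
  push_cast at h1
  rw [Finset.mul_sum]
  exact (Finset.sum_le_sum h.le_card).trans h1

theorem IsTiling.card_region_le_sum (h : IsTiling σ F L ε N 𝒯) (hL : ∀ n ∈ N, F n ⊆ L) :
    ((region σ 𝒯).card : ℝ) ≤ ∑ τ ∈ 𝒯, ((F τ.shape).card : ℝ) := by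
  rw [← h.sum_card_part hL]
  push_cast
  exact Finset.sum_le_sum fun τ hτ => by exact_mod_cast Finset.card_le_card (h.part_subset τ hτ)

/-- Greedy extension of a tiling by tiles of one more shape. -/
theorem IsTiling.exists_saturated {m : ℕ} (hε1 : ε < 1) (hm : (F m).Nonempty) (hmN : m ∈ N) :
    ∀ 𝒯 : Finset (Tile G d), IsTiling σ F L ε N 𝒯 →
      ∃ 𝒯', IsTiling σ F L ε N 𝒯' ∧ region σ 𝒯 ⊆ region σ 𝒯' ∧
        ∀ c ∈ goodSet σ L, ε * (F m).card <
          ((F m).filter fun f => σ f c ∈ region σ 𝒯').card := by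
  classical
  intro 𝒯
  -- Each added tile covers new points, so the number of uncovered points is a termination measure.
  induction hk : d - (region σ 𝒯).card using Nat.strong_induction_on generalizing 𝒯 with
  | _ k ih =>
  intro h
  by_cases hsat : ∀ c ∈ goodSet σ L, ε * (F m).card <
      ((F m).filter fun f => σ f c ∈ region σ 𝒯).card
  · exact ⟨𝒯, h, subset_rfl, hsat⟩
  push Not at hsat
  obtain ⟨c, hc, hcard⟩ := hsat
  -- Keeping only the uncovered points of the translate makes the new tile disjoint from the old
  -- ones; the discarded points are already covered, which preserves `full`.
  set T := (F m).filter fun f => ¬ σ f c ∈ region σ 𝒯 with hT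
  set τ₀ : Tile G d := ⟨c, m, T⟩ with hτ₀
  have hcardT : (1 - ε) * (F m).card ≤ T.card := by
    have := Finset.card_filter_add_card_filter_not (s := F m) (fun f => σ f c ∈ region σ 𝒯)
    have h2 : (((F m).filter fun f => σ f c ∈ region σ 𝒯).card : ℝ) + T.card = (F m).card := by
      exact_mod_cast this
    linarith
  have hTne : T.Nonempty := by
    rw [← Finset.card_pos]
    have : (0 : ℝ) < (F m).card := by exact_mod_cast Finset.card_pos.mpr hm
    have h3 : (0 : ℝ) < (1 - ε) * (F m).card := mul_pos (by linarith) this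
    exact_mod_cast h3.trans_le hcardT
  have hreg : region σ (insert τ₀ 𝒯) = τ₀.points σ ∪ region σ 𝒯 := by
    simp [region, Finset.biUnion_insert]
  have hdisj : Disjoint (τ₀.points σ) (region σ 𝒯) := by
    rw [Finset.disjoint_left]
    intro j hj
    simp only [Tile.points, Finset.mem_image, hτ₀] at hj
    obtain ⟨t, ht, rfl⟩ := hj
    exact (Finset.mem_filter.mp ht).2
  have hpts : (τ₀.points σ).Nonempty := by simpa [Tile.points, hτ₀] using hTne
  have hdisj' : ∀ τ ∈ 𝒯, Disjoint (τ₀.points σ) (τ.points σ) := fun τ hτ =>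
    hdisj.mono_right (Finset.subset_biUnion_of_mem (Tile.points σ) hτ)
  have hnew : IsTiling σ F L ε N (insert τ₀ 𝒯) := by
    refine ⟨?_, ?_, ?_, ?_, ?_, ?_⟩
    · exact Finset.forall_mem_insert _ _ _ |>.mpr ⟨hc, h.good⟩
    · exact Finset.forall_mem_insert _ _ _ |>.mpr ⟨hmN, h.shape_mem⟩
    · exact Finset.forall_mem_insert _ _ _ |>.mpr ⟨Finset.filter_subset _ _, h.part_subset⟩
    · exact Finset.forall_mem_insert _ _ _ |>.mpr ⟨hcardT, h.le_card⟩
    · intro τ hτ τ' hτ' hne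
      rcases Finset.mem_insert.mp hτ with rfl | hτ <;>
      rcases Finset.mem_insert.mp hτ' with rfl | hτ'
      · exact absurd rfl hne
      · exact hdisj' _ hτ'
      · exact (hdisj' _ hτ).symm
      · exact h.disjoint τ hτ τ' hτ' hne
    · rw [hreg]
      refine Finset.forall_mem_insert _ _ _ |>.mpr ⟨fun f hf => ?_, fun τ hτ f hf =>
        Finset.mem_union_right _ (h.full τ hτ f hf)⟩
      by_cases hfr : σ f c ∈ region σ 𝒯
      · exact Finset.mem_union_right _ hfr
      · exact Finset.mem_union_left _
          (Finset.mem_image.mpr ⟨f, Finset.mem_filter.mpr ⟨hf, hfr⟩, rfl⟩)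
  have hcardreg : (region σ 𝒯).card < (region σ (insert τ₀ 𝒯)).card := by
    rw [hreg, Finset.card_union_of_disjoint hdisj]
    have := Finset.card_pos.mpr hpts
    omega
  have hle : (region σ (insert τ₀ 𝒯)).card ≤ d :=
    (Finset.card_le_univ _).trans (Fintype.card_fin d).le
  obtain ⟨𝒯', h1, h2, h3⟩ := ih _ (by omega) (insert τ₀ 𝒯) rfl hnew
  exact ⟨𝒯', h1, (hreg ▸ Finset.subset_union_right).trans h2, h3⟩

open Classical in
-- If `σ s j` is the point `t` of a tile and `s⁻¹ * t` were in the whole shape, then `j` would be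
-- covered by `full`. Thus only the invariance of the shapes matters, not that of the parts. The
-- factor 2 bounds `1 / (1 - ε)`.
theorem IsTiling.card_boundary_le (h : IsTiling σ F L ε N 𝒯) (hε : ε ≤ 1 / 2)
    (hL : ∀ n ∈ N, F n ⊆ L) {s : G} (hs : s ∈ L) {θ : ℝ} (hθ : 0 ≤ θ)
    (hinv : ∀ n ∈ N, (((F n).filter fun f => s⁻¹ * f ∉ F n).card : ℝ) ≤ θ * (F n).card) :
    ((Finset.univ.filter fun j => j ∉ region σ 𝒯 ∧ σ s j ∈ region σ 𝒯).card : ℝ) ≤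
      2 * θ * d := by
  have h1 : (Finset.univ.filter fun j => j ∉ region σ 𝒯 ∧ σ s j ∈ region σ 𝒯).card ≤
      ∑ τ ∈ 𝒯, ((F τ.shape).filter fun f => s⁻¹ * f ∉ F τ.shape).card := by
    refine le_trans (Finset.card_le_card (t := 𝒯.biUnion fun τ =>
      ((F τ.shape).filter fun f => s⁻¹ * f ∉ F τ.shape).image
        fun f => (σ s).symm (σ f τ.center)) ?_)
      (Finset.card_biUnion_le.trans (Finset.sum_le_sum fun τ _ => Finset.card_image_le))
    intro j hj
    obtain ⟨-, hj, hsj⟩ := Finset.mem_filter.mp hj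
    obtain ⟨τ, hτ, t, ht, hteq⟩ := mem_region.mp hsj
    refine Finset.mem_biUnion.mpr ⟨τ, hτ, Finset.mem_image.mpr ⟨t, Finset.mem_filter.mpr
      ⟨h.part_subset τ hτ ht, fun hmem => hj ?_⟩, by rw [hteq]; simp⟩⟩
    have h2 := (mem_goodSet.mp (h.good τ hτ)).1 s hs _ (hL _ (h.shape_mem τ hτ) hmem)
    rw [mul_inv_cancel_left, hteq] at h2
    rw [← (σ s).injective h2]
    exact h.full τ hτ _ hmem
  have h3 := h.sum_card_shape_le hL
  have h4 : (0 : ℝ) ≤ ∑ τ ∈ 𝒯, ((F τ.shape).card : ℝ) := by positivity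
  calc ((Finset.univ.filter fun j => j ∉ region σ 𝒯 ∧ σ s j ∈ region σ 𝒯).card : ℝ)
      ≤ ∑ τ ∈ 𝒯, (((F τ.shape).filter fun f => s⁻¹ * f ∉ F τ.shape).card : ℝ) := by
        exact_mod_cast h1
    _ ≤ ∑ τ ∈ 𝒯, θ * ((F τ.shape).card : ℝ) :=
        Finset.sum_le_sum fun τ hτ => hinv _ (h.shape_mem τ hτ)
    _ = θ * ∑ τ ∈ 𝒯, ((F τ.shape).card : ℝ) := by rw [Finset.mul_sum]
    _ ≤ θ * (2 * d) := mul_le_mul_of_nonneg_left (by nlinarith) hθ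
    _ = 2 * θ * d := by ring

open Classical in
theorem IsFolnerSequence.eventually_card_filter_le (hF : IsFolnerSequence F) (K : Finset G)
    {θ : ℝ} (hθ : 0 < θ) : ∀ᶠ n in atTop, ∀ s ∈ K,
      (((F n).filter fun f => s⁻¹ * f ∉ F n).card : ℝ) ≤ θ * (F n).card := by
  rw [Filter.eventually_all_finset]
  intro s _
  filter_upwards [(hF.tendsto_symmDiff s).eventually_lt_const hθ] with n hn
  have hpos : (0 : ℝ) < (F n).card := by exact_mod_cast Finset.card_pos.mpr (hF.nonempty n)
  rw [div_lt_iff₀ hpos] at hn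
  refine le_trans ?_ hn.le
  refine Nat.cast_le.mpr (Finset.card_le_card fun f hf => ?_)
  obtain ⟨h1, h2⟩ := Finset.mem_filter.mp hf
  refine Finset.mem_symmDiff.mpr (Or.inr ⟨h1, fun h3 => h2 ?_⟩)
  obtain ⟨x, hx, rfl⟩ := Finset.mem_image.mp h3
  simpa using hx

open Classical in
/-- One more shape shrinks the uncovered part by the factor `1 - ε`. -/
theorem IsTiling.exists_extension (h : IsTiling σ F L ε N 𝒯) (hε0 : 0 < ε) (hε : ε ≤ 1 / 2)
    (hL : ∀ n ∈ N, F n ⊆ L) {m : ℕ} (hm : (F m).Nonempty) (hmL : F m ⊆ L) {γ q : ℝ}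
    (hγ : 0 < γ) (hgood : (1 - γ) * d ≤ (goodSet σ L).card)
    (hinv : ∀ n ∈ N, ∀ s ∈ F m, (((F n).filter fun f => s⁻¹ * f ∉ F n).card : ℝ) ≤
      (γ / (F m).card) * (F n).card)
    (hq : ((region σ 𝒯)ᶜ.card : ℝ) ≤ (q + 3 * γ) * d) :
    ∃ 𝒯', IsTiling σ F L ε (insert m N) 𝒯' ∧
      ((region σ 𝒯')ᶜ.card : ℝ) ≤ ((1 - ε) * q + 3 * γ) * d := by
  have h0 : IsTiling σ F L ε (insert m N) 𝒯 :=
    ⟨h.good, fun τ hτ => Finset.mem_insert_of_mem (h.shape_mem τ hτ), h.part_subset, h.le_card,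
      h.disjoint, h.full⟩
  obtain ⟨𝒯', h1, hsub, hsat⟩ := IsTiling.exists_saturated (by linarith) hm
    (Finset.mem_insert_self m N) 𝒯 h0
  refine ⟨𝒯', h1, ?_⟩
  set A := region σ 𝒯
  set A' := region σ 𝒯'
  have hmpos : (0 : ℝ) < (F m).card := by exact_mod_cast Finset.card_pos.mpr hm
  set W := (goodSet σ L).filter fun c => c ∉ A ∧ ∀ s ∈ F m, σ s c ∉ A with hW
  -- Double count the pairs `(c, f)` with `σ f c ∈ A' \ A`: saturation gives more than `ε |F m|` for
  -- each `c ∈ W`, while each bijection `σ f` contributes `|A' \ A|`.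
  have hWle : ε * W.card ≤ (A' \ A).card := by
    have e1 : ∑ c ∈ W, ε * ((F m).card : ℝ) ≤
        ∑ c, ∑ f ∈ F m, if σ f c ∈ A' \ A then (1 : ℝ) else 0 := by
      refine (Finset.sum_le_sum fun c hc => ?_).trans
        (Finset.sum_le_sum_of_subset_of_nonneg (Finset.subset_univ W) fun _ _ _ =>
          Finset.sum_nonneg fun _ _ => by split_ifs <;> norm_num)
      obtain ⟨hcg, hcA, hcs⟩ := Finset.mem_filter.mp hc
      refine (hsat c hcg).le.trans ?_
      rw [Finset.sum_boole]
      refine Nat.cast_le.mpr (Finset.card_le_card fun f hf => ?_)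
      obtain ⟨hf1, hf2⟩ := Finset.mem_filter.mp hf
      exact Finset.mem_filter.mpr ⟨hf1, Finset.mem_sdiff.mpr ⟨hf2, hcs f hf1⟩⟩
    rw [Finset.sum_comm] at e1
    have e2 : ∀ f ∈ F m, (∑ c, if σ f c ∈ A' \ A then (1 : ℝ) else 0) = (A' \ A).card := by
      intro f _
      rw [Equiv.sum_comp (σ f) (fun c => if c ∈ A' \ A then (1 : ℝ) else 0), Finset.sum_boole,
        Finset.filter_mem_eq_inter, Finset.univ_inter]
    rw [Finset.sum_congr rfl e2, Finset.sum_const, Finset.sum_const, nsmul_eq_mul, nsmul_eq_mul]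
      at e1
    refine le_of_mul_le_mul_left ?_ hmpos
    linarith
  -- One `γ` pays for the points outside `goodSet`, two for the boundary terms summed over `F m`.
  -- The error `3γ` is a fixed point of the resulting recursion, so it does not accumulate.
  have hAW : (Aᶜ.card : ℝ) ≤ W.card + 3 * γ * d := by
    have e1 : Aᶜ.card ≤ W.card + (goodSet σ L)ᶜ.card + ∑ s ∈ F m,
        (Finset.univ.filter fun j => j ∉ A ∧ σ s j ∈ A).card := by
      refine le_trans (Finset.card_le_card (t := (W ∪ (goodSet σ L)ᶜ) ∪ (F m).biUnion fun s =>
        Finset.univ.filter fun j => j ∉ A ∧ σ s j ∈ A) fun c hc => ?_) ?_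
      · rw [Finset.mem_compl] at hc
        simp only [Finset.mem_union, hW, Finset.mem_filter, Finset.mem_compl, Finset.mem_biUnion,
          Finset.mem_univ, true_and]
        by_cases hg : c ∈ goodSet σ L
        · by_cases hs : ∀ s ∈ F m, σ s c ∉ A
          · exact Or.inl (Or.inl ⟨hg, hc, hs⟩)
          · push Not at hs
            obtain ⟨s, hs, hsA⟩ := hs
            exact Or.inr ⟨s, hs, hc, hsA⟩
        · exact Or.inl (Or.inr hg)
      · exact (Finset.card_union_le _ _).trans
          (add_le_add (Finset.card_union_le _ _) Finset.card_biUnion_le)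
    have e2 : ∀ s ∈ F m, ((Finset.univ.filter fun j => j ∉ A ∧ σ s j ∈ A).card : ℝ) ≤
        2 * (γ / (F m).card) * d := fun s hs =>
      h.card_boundary_le hε hL (hmL hs) (by positivity) fun n hn => hinv n hn s hs
    have e3 := Finset.sum_le_sum e2
    rw [Finset.sum_const, nsmul_eq_mul] at e3
    have e4 : ((F m).card : ℝ) * (2 * (γ / (F m).card) * d) = 2 * γ * d := by field_simp
    have e5 : (Aᶜ.card : ℝ) ≤ _ := Nat.cast_le.mpr e1
    push_cast at e5
    have e6 : ((goodSet σ L).card : ℝ) + ((goodSet σ L)ᶜ.card : ℝ) = d := by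
      have := Finset.card_add_card_compl (goodSet σ L)
      rw [Fintype.card_fin] at this
      exact_mod_cast this
    linarith
  have hA' : (A'ᶜ.card : ℝ) = Aᶜ.card - (A' \ A).card := by
    have : A'ᶜ.card + (A' \ A).card = Aᶜ.card := by
      rw [← Finset.card_union_of_disjoint]
      · congr 1
        ext j
        have := @hsub j
        simp only [Finset.mem_union, Finset.mem_compl, Finset.mem_sdiff]
        tauto
      · rw [Finset.disjoint_left]
        intro j hj hj'
        exact (Finset.mem_compl.mp hj) (Finset.mem_sdiff.mp hj').1
    rw [← this]
    push_cast
    ring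
  have h7 : ε * (Aᶜ.card : ℝ) ≤ ε * (W.card + 3 * γ * d) := mul_le_mul_of_nonneg_left hAW hε0.le
  have h8 : (1 - ε) * (Aᶜ.card : ℝ) ≤ (1 - ε) * ((q + 3 * γ) * d) :=
    mul_le_mul_of_nonneg_left hq (by linarith)
  rw [hA']
  nlinarith

open Classical in
-- Shapes are laid in the reverse order of their choice: `m` is chosen before the shapes in `N`,
-- which must be nearly invariant under `F m`, but it fills the gaps that they leave. Hence `K` and
-- `θ` stay quantified inside the induction.
theorem IsFolnerSequence.exists_tilings (hF : IsFolnerSequence F) {p : ℕ → Prop}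
    (hp : ∃ᶠ n in atTop, p n) (hε0 : 0 < ε) (hε : ε ≤ 1 / 2) {γ : ℝ} (hγ : 0 < γ) (k : ℕ) :
    ∀ (K : Finset G) (θ : ℝ), 0 < θ → ∃ N : Finset ℕ,
      (∀ n ∈ N, p n ∧ ∀ s ∈ K,
        (((F n).filter fun f => s⁻¹ * f ∉ F n).card : ℝ) ≤ θ * (F n).card) ∧
      ∀ (L : Finset G), (∀ n ∈ N, F n ⊆ L) → ∀ (d : ℕ) (σ : G → Equiv.Perm (Fin d)),
        (1 - γ) * d ≤ (goodSet σ L).card → ∃ 𝒯, IsTiling σ F L ε N 𝒯 ∧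
          ((region σ 𝒯)ᶜ.card : ℝ) ≤ ((1 - ε) ^ k + 3 * γ) * d := by
  induction k with
  | zero =>
    intro K θ _
    refine ⟨∅, by simp, fun L _ d σ _ => ⟨∅, ⟨?_, ?_, ?_, ?_, ?_, ?_⟩, ?_⟩⟩ <;> try simp
    simp only [region, Finset.biUnion_empty, Finset.compl_empty, Finset.card_univ,
      Fintype.card_fin]
    nlinarith [(Nat.cast_nonneg d : (0 : ℝ) ≤ d)]
  | succ k ih =>
    intro K θ hθ
    obtain ⟨m, hpm, hm⟩ := (hp.and_eventually (hF.eventually_card_filter_le K hθ)).exists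
    have hmpos : (0 : ℝ) < (F m).card := by exact_mod_cast Finset.card_pos.mpr (hF.nonempty m)
    obtain ⟨N, hN, hT⟩ := ih (K ∪ F m) (min θ (γ / (F m).card)) (lt_min hθ (by positivity))
    refine ⟨insert m N, ?_, fun L hL d σ hσ => ?_⟩
    · refine Finset.forall_mem_insert _ _ _ |>.mpr ⟨⟨hpm, hm⟩, fun n hn => ⟨(hN n hn).1,
        fun s hs => ((hN n hn).2 s (Finset.mem_union_left _ hs)).trans ?_⟩⟩
      gcongr
      exact min_le_left _ _
    · have hL' := (Finset.forall_mem_insert _ _ _).mp hL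
      obtain ⟨𝒯, h1, h2⟩ := hT L hL'.2 d σ hσ
      obtain ⟨𝒯', h3, h4⟩ := h1.exists_extension hε0 hε hL'.2 (hF.nonempty m) hL'.1 hγ hσ
        (fun n hn s hs => ((hN n hn).2 s (Finset.mem_union_right _ hs)).trans (by
          gcongr
          exact min_le_right _ _)) h2
      exact ⟨𝒯', h3, h4.trans_eq (by ring)⟩

open Classical in
/-- Sofic approximations of an amenable group are quasi-tiled by the shapes of any subsequence of
a Følner sequence. -/
theorem IsFolnerSequence.exists_quasiTiling (hF : IsFolnerSequence F) {p : ℕ → Prop}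
    (hp : ∃ᶠ n in atTop, p n) (hε0 : 0 < ε) (hε : ε ≤ 1 / 2) (K : Finset G) :
    ∃ N : Finset ℕ,
      (∀ n ∈ N, p n ∧ ∀ s ∈ K,
        (((F n).filter fun f => s⁻¹ * f ∉ F n).card : ℝ) ≤ ε * (F n).card) ∧
      ∀ (L : Finset G), (∀ n ∈ N, F n ⊆ L) → ∀ (d : ℕ) (σ : G → Equiv.Perm (Fin d)),
        (1 - ε) * d ≤ (goodSet σ L).card → ∃ 𝒯, IsTiling σ F L ε N 𝒯 ∧
          ((region σ 𝒯)ᶜ.card : ℝ) ≤ 4 * ε * d := by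
  obtain ⟨k, hk⟩ := exists_pow_lt_of_lt_one hε0 (show 1 - ε < 1 by linarith)
  obtain ⟨N, hN, h⟩ := hF.exists_tilings hp hε0 hε hε0 k K ε hε0
  refine ⟨N, hN, fun L hL d σ hσ => ?_⟩
  obtain ⟨𝒯, h1, h2⟩ := h L hL d σ hσ
  refine ⟨𝒯, h1, h2.trans ?_⟩
  have : (0 : ℝ) ≤ d := Nat.cast_nonneg d
  nlinarith

end QuasiTiling

/-! ### Neighbourhoods of the identity in a compact group -/

section CompactGroup

theorem exists_small_cover {X : Type*} [TopologicalSpace X] [CompactSpace X] [Group X]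
    [IsTopologicalGroup X] {P : Set X} (hP : P ∈ 𝓝 (1 : X)) :
    ∃ U : Set (Set X), IsFiniteOpenCover U ∧ ∀ u ∈ U, ∀ x ∈ u, ∀ y ∈ u, x⁻¹ * y ∈ P := by
  have h : ∀ x : X, ∃ u : Set X, IsOpen u ∧ x ∈ u ∧ ∀ a ∈ u, ∀ b ∈ u, a⁻¹ * b ∈ P := by
    intro x
    have hc : ContinuousAt (fun q : X × X => q.1⁻¹ * q.2) (x, x) := by fun_prop
    have := hc.preimage_mem_nhds (show P ∈ 𝓝 (x⁻¹ * x) by simpa using hP)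
    rw [nhds_prod_eq, Filter.mem_prod_same_iff] at this
    obtain ⟨t, ht, hsub⟩ := this
    obtain ⟨u, hut, huo, hxu⟩ := mem_nhds_iff.mp ht
    exact ⟨u, huo, hxu, fun a ha b hb => hsub (Set.mk_mem_prod (hut ha) (hut hb))⟩
  choose u huo hxu hu using h
  obtain ⟨t, ht⟩ := isCompact_univ.elim_finite_subcover u huo
    (fun x _ => Set.mem_iUnion.mpr ⟨x, hxu x⟩)
  refine ⟨u '' (t : Set X), ⟨t.finite_toSet.image u, ?_, ?_⟩, ?_⟩
  · rintro _ ⟨x, -, rfl⟩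
    exact huo x
  · rw [Set.sUnion_image]
    exact Set.eq_univ_of_univ_subset ht
  · rintro _ ⟨x, -, rfl⟩
    exact hu x

theorem exists_cell {X : Type*} [TopologicalSpace X] [CompactSpace X] [Group X]
    [IsTopologicalGroup X] {P : Set X} (hP : P ∈ 𝓝 (1 : X)) :
    ∃ (M : ℕ) (cell : X → Fin M), ∀ x y, cell x = cell y → x⁻¹ * y ∈ P := by
  obtain ⟨U, hU, hUP⟩ := exists_small_cover hP
  have : ∀ x : X, ∃ u ∈ U, x ∈ u := fun x => by
    have : x ∈ ⋃₀ U := hU.sUnion_eq ▸ Set.mem_univ x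
    simpa using this
  choose u huU hxu using this
  have hfin : Finite U := hU.finite
  obtain ⟨M, ⟨e⟩⟩ := Finite.exists_equiv_fin U
  refine ⟨M, fun x => e ⟨u x, huU x⟩, fun x y hxy => ?_⟩
  have h1 : u x = u y := congrArg Subtype.val (e.injective hxy)
  exact hUP _ (huU x) x (hxu x) y (h1 ▸ hxu y)

variable {X : Type*} [MetricSpace X] [CompactSpace X] [Group X] [IsTopologicalGroup X]

theorem exists_nhds_forall_dist_mul_lt {κ : ℝ} (hκ : 0 < κ) :
    ∃ P ∈ 𝓝 (1 : X), ∀ x : X, ∀ p ∈ P, dist (x * p) x < κ := by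
  have hc : UniformContinuous fun q : X × X => q.1 * q.2 :=
    CompactSpace.uniformContinuous_of_continuous (by fun_prop)
  obtain ⟨r, hr, h⟩ := Metric.uniformContinuous_iff.mp hc κ hκ
  refine ⟨Metric.ball 1 r, Metric.ball_mem_nhds _ hr, fun x p hp => ?_⟩
  have := @h (x, p) (x, 1) (by
    rw [Prod.dist_eq]
    simpa [hr] using hp)
  simpa using this

theorem exists_forall_dist_lt_inv_mul_mem {P : Set X} (hP : P ∈ 𝓝 (1 : X)) :
    ∃ κ > 0, ∀ a b : X, dist a b < κ → a⁻¹ * b ∈ P := by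
  obtain ⟨ε, hε, hεP⟩ := Metric.mem_nhds_iff.mp hP
  have hc : UniformContinuous fun q : X × X => q.1⁻¹ * q.2 :=
    CompactSpace.uniformContinuous_of_continuous (by fun_prop)
  obtain ⟨r, hr, h⟩ := Metric.uniformContinuous_iff.mp hc ε hε
  refine ⟨r, hr, fun a b hab => hεP ?_⟩
  have := @h (a, b) (a, a) (by
    rw [Prod.dist_eq]
    simpa [hr, dist_comm] using hab)
  simpa using this

theorem IsFiniteOpenCover.exists_lebesgue_nhds {U : Set (Set X)} (hU : IsFiniteOpenCover U) :
    ∃ P ∈ 𝓝 (1 : X), (∀ p ∈ P, p⁻¹ ∈ P) ∧ ∀ x : X, ∃ u ∈ U, ∀ p ∈ P, x * p ∈ u := by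
  obtain ⟨κ, hκ, h⟩ := lebesgue_number_lemma_of_metric_sUnion (s := (Set.univ : Set X))
    isCompact_univ hU.isOpen (hU.sUnion_eq.symm ▸ subset_rfl)
  obtain ⟨P, hP, hPκ⟩ := exists_nhds_forall_dist_mul_lt (X := X) hκ
  refine ⟨P ∩ P⁻¹, Filter.inter_mem hP (inv_mem_nhds_one X hP), fun p hp => ⟨hp.2, ?_⟩,
    fun x => ?_⟩
  · simpa using hp.1
  · obtain ⟨u, hu, hxu⟩ := h x (Set.mem_univ x)
    exact ⟨u, hu, fun p hp => hxu (hPκ x p hp.1)⟩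

end CompactGroup

/-! ### Covering numbers and separated sets -/

section Covering

/-- A separated set that cannot be enlarged is a net, and one member of `V` per net point suffices.
The bound `M` stops the enlargement. -/
theorem coverNumber_le_of_separated {Y : Type*} {R : Y → Y → Prop} (hrefl : ∀ y, R y y)
    (hsymm : ∀ y z, R y z → R z y) {V : Set (Set Y)} (hV : ∀ y, ∃ v ∈ V, ∀ z, R y z → z ∈ v)
    {Z : Set Y} {M : ℕ} (h : ∀ E : Finset Y, (E : Set Y) ⊆ Z →
      (∀ x ∈ E, ∀ y ∈ E, x ≠ y → ¬ R x y) → E.card ≤ M) :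
    coverNumber V Z ≤ M := by
  classical
  have key : ∃ E : Finset Y, E.card ≤ M ∧ ∀ z ∈ Z, ∃ e ∈ E, R e z := by
    by_contra! hcon
    have : ∀ n : ℕ, ∃ E : Finset Y, (E : Set Y) ⊆ Z ∧
        (∀ x ∈ E, ∀ y ∈ E, x ≠ y → ¬ R x y) ∧ E.card = n := by
      intro n
      induction n with
      | zero => exact ⟨∅, by simp, by simp, rfl⟩
      | succ n ih =>
        obtain ⟨E, hEZ, hE, hn⟩ := ih
        obtain ⟨z, hz, hzE⟩ := hcon E (h E hEZ hE)
        have hzn : z ∉ E := fun hzE' => hzE z hzE' (hrefl z)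
        refine ⟨insert z E, ?_, ?_, by rw [Finset.card_insert_of_notMem hzn, hn]⟩
        · rw [Finset.coe_insert]
          exact Set.insert_subset hz hEZ
        · intro x hx y hy hxy
          rcases Finset.mem_insert.mp hx with hx' | hx' <;>
          rcases Finset.mem_insert.mp hy with hy' | hy'
          · exact absurd (hx'.trans hy'.symm) hxy
          · exact fun hR => hzE y hy' (hsymm _ _ (hx' ▸ hR))
          · exact hy' ▸ hzE x hx'
          · exact hE x hx' y hy' hxy
    obtain ⟨E, h1, h2, h3⟩ := this (M + 1)
    have := h E h1 h2
    omega
  obtain ⟨E, hEM, hE⟩ := key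
  choose v hvV hv using hV
  calc coverNumber V Z ≤ (v '' (E : Set Y)).encard := by
        refine iInf₂_le_of_le (v '' (E : Set Y)) ?_ (iInf_le_of_le ?_ le_rfl)
        · rintro _ ⟨y, -, rfl⟩
          exact hvV y
        · intro z hz
          obtain ⟨e, he, hez⟩ := hE z hz
          exact Set.mem_sUnion.mpr ⟨v e, ⟨e, he, rfl⟩, hv e z hez⟩
    _ ≤ (E : Set Y).encard := Set.encard_image_le _ _
    _ = (E.card : ℕ∞) := Set.encard_coe_eq_coe_finsetCard E
    _ ≤ M := by exact_mod_cast hEM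

theorem exists_subcover_of_coverNumber_le {Y : Type*} {V : Set (Set Y)} {K : Set Y} {M : ℕ}
    (h : coverNumber V K ≤ M) : ∃ S ⊆ V, K ⊆ ⋃₀ S ∧ S.Finite ∧ S.ncard ≤ M := by
  have h1 : coverNumber V K < ((M + 1 : ℕ) : ℕ∞) :=
    h.trans_lt (by exact_mod_cast Nat.lt_succ_self M)
  simp only [coverNumber, iInf_lt_iff] at h1
  obtain ⟨S, hSV, hKS, hS⟩ := h1
  have hfin : S.Finite := Set.finite_of_encard_le_coe hS.le
  refine ⟨S, hSV, hKS, hfin, ?_⟩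
  rw [← hfin.cast_ncard_eq] at hS
  have : S.ncard < M + 1 := by exact_mod_cast hS
  omega

theorem logCard_div_le {n : ℕ∞} {M d : ℕ} {a : ℝ} (hd : 0 < d) (hn : n ≤ M)
    (hM : (M : ℝ) ≤ Real.exp (a * d)) : logCard n / ((d : ℝ) : EReal) ≤ a := by
  have hd' : (0 : ℝ) < d := by exact_mod_cast hd
  rw [EReal.div_le_iff_le_mul (by exact_mod_cast hd') (EReal.coe_ne_top _)]
  have h1 : (n : ENNReal) ≤ ENNReal.ofReal (Real.exp (a * d)) := by
    calc (n : ENNReal) ≤ ((M : ℕ∞) : ENNReal) := ENat.toENNReal_le.mpr hn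
      _ = ENNReal.ofReal (M : ℝ) := by simp
      _ ≤ _ := ENNReal.ofReal_le_ofReal hM
  refine (ENNReal.log_monotone h1).trans ?_
  rw [ENNReal.log_ofReal_of_pos (Real.exp_pos _), Real.log_exp, mul_comm]
  simp

theorem exists_le_exp_of_logCard_div_lt {n : ℕ∞} {d : ℕ} {a : ℝ} (hd : 0 < d)
    (h : logCard n / ((d : ℝ) : EReal) < a) :
    ∃ M : ℕ, n = M ∧ (M : ℝ) ≤ Real.exp (a * d) := by
  have hd' : (0 : ℝ) < d := by exact_mod_cast hd
  have h1 := h.le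
  rw [EReal.div_le_iff_le_mul (by exact_mod_cast hd') (EReal.coe_ne_top _)] at h1
  have h2 : logCard n ≤ ENNReal.log (ENNReal.ofReal (Real.exp (a * d))) := by
    rw [ENNReal.log_ofReal_of_pos (Real.exp_pos _), Real.log_exp, mul_comm]
    simpa using h1
  have h3 : (n : ENNReal) ≤ ENNReal.ofReal (Real.exp (a * d)) := ENNReal.log_le_log_iff.mp h2
  have h4 : n ≠ ⊤ := by
    rintro rfl
    simp at h3
  obtain ⟨M, rfl⟩ := ENat.ne_top_iff_exists.mp h4
  refine ⟨M, rfl, ?_⟩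
  have h5 : ENNReal.ofReal (M : ℝ) ≤ ENNReal.ofReal (Real.exp (a * d)) := by simpa using h3
  exact (ENNReal.ofReal_le_ofReal_iff (Real.exp_pos _).le).mp h5

end Covering

/-! ### Almost equivariant points -/

section AlmostEquivariant

variable {G X : Type*} [Group G] [MetricSpace X]

/-- Chebyshev's inequality: the mean-square condition becomes a count of bad coordinates, which is
easier to combine. -/
theorem card_filter_le_of_mem_almostEquivariant [MulAction G X] {d : ℕ} {K : Finset G} {δ κ : ℝ}
    {σ : G → Equiv.Perm (Fin d)} {x : Fin d → X} (hx : x ∈ almostEquivariant K δ σ) {s : G}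
    (hs : s ∈ K) (hκ : 0 < κ) :
    ((Finset.univ.filter fun j => κ ≤ dist (s • x j) (x (σ s j))).card : ℝ) ≤
      δ ^ 2 / κ ^ 2 * d := by
  rcases Nat.eq_zero_or_pos d with rfl | hd
  · simp
  have hd' : (0 : ℝ) < d := by exact_mod_cast hd
  have h1 := hx s hs
  have hδ : 0 < δ := (Real.sqrt_nonneg _).trans_lt h1
  rw [Real.sqrt_lt' hδ, ← Finset.mul_sum, one_div, inv_mul_lt_iff₀ hd'] at h1
  have h2 : ((Finset.univ.filter fun j => κ ≤ dist (s • x j) (x (σ s j))).card : ℝ) * κ ^ 2 ≤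
      ∑ j, dist (s • x j) (x (σ s j)) ^ 2 := by
    rw [← nsmul_eq_mul]
    refine (Finset.card_nsmul_le_sum _ (fun j => dist (s • x j) (x (σ s j)) ^ 2) _
      fun j hj => ?_).trans (Finset.sum_le_sum_of_subset_of_nonneg (Finset.subset_univ _)
        fun _ _ _ => by positivity)
    exact pow_le_pow_left₀ hκ.le (Finset.mem_filter.mp hj).2 2
  rw [div_mul_eq_mul_div, le_div_iff₀ (by positivity)]
  linarith

theorem mem_almostEquivariant_of_card_filter_le [MulAction G X] {d : ℕ} (hd : 0 < d)
    {K : Finset G} {δ κ β D : ℝ} {σ : G → Equiv.Perm (Fin d)} {x : Fin d → X}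
    (hD : ∀ a b : X, dist a b ≤ D) (hδ : 0 < δ)
    (hβ : κ ^ 2 + β * D ^ 2 < δ ^ 2)
    (h : ∀ s ∈ K, ((Finset.univ.filter fun j => κ ≤ dist (s • x j) (x (σ s j))).card : ℝ) ≤
      β * d) : x ∈ almostEquivariant K δ σ := by
  intro s hs
  have hd' : (0 : ℝ) < d := by exact_mod_cast hd
  rw [Real.sqrt_lt' hδ, ← Finset.mul_sum, one_div, inv_mul_lt_iff₀ hd']
  have h1 : ∀ j, dist (s • x j) (x (σ s j)) ^ 2 ≤
      κ ^ 2 + if κ ≤ dist (s • x j) (x (σ s j)) then D ^ 2 else 0 := by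
    intro j
    split_ifs with hj
    · have := pow_le_pow_left₀ dist_nonneg (hD (s • x j) (x (σ s j))) 2
      nlinarith
    · have := pow_le_pow_left₀ dist_nonneg (not_le.mp hj).le 2
      linarith
  calc ∑ j, dist (s • x j) (x (σ s j)) ^ 2
      ≤ ∑ j, (κ ^ 2 + if κ ≤ dist (s • x j) (x (σ s j)) then D ^ 2 else 0) :=
        Finset.sum_le_sum fun j _ => h1 j
    _ = d * κ ^ 2 +
        (Finset.univ.filter fun j => κ ≤ dist (s • x j) (x (σ s j))).card * D ^ 2 := by
        rw [Finset.sum_add_distrib, ← Finset.sum_filter]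
        simp
    _ ≤ d * κ ^ 2 + β * d * D ^ 2 := by
        have := h s hs
        gcongr
    _ < d * δ ^ 2 := by nlinarith

/-- The group acts by automorphisms, so equivariance fails noticeably for the product only where it
fails for a factor; uniform continuity handles the remaining coordinates. -/
theorem exists_forall_mul_inv_mul_mem_almostEquivariant [CompactSpace X] [Group X]
    [IsTopologicalGroup X] [MulDistribMulAction G X] {δ : ℝ} (hδ : 0 < δ) :
    ∃ δ' > 0, ∀ (d : ℕ), 0 < d → ∀ (K : Finset G) (σ : G → Equiv.Perm (Fin d)),
      ∀ x ∈ almostEquivariant (X := X) K δ' σ, ∀ y ∈ almostEquivariant (X := X) K δ' σ,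
      ∀ z ∈ almostEquivariant (X := X) K δ' σ,
        (fun j => x j * (y j)⁻¹ * z j) ∈ almostEquivariant K δ σ := by
  classical
  obtain ⟨D, hD⟩ : ∃ D, ∀ a b : X, dist a b ≤ D :=
    ⟨_, fun a b => Metric.dist_le_diam_of_mem (isCompact_univ.isBounded) (Set.mem_univ a)
      (Set.mem_univ b)⟩
  have hD0 : 0 ≤ D := dist_nonneg.trans (hD 1 1)
  have hc : UniformContinuous fun q : X × X × X => q.1 * q.2.1⁻¹ * q.2.2 :=
    CompactSpace.uniformContinuous_of_continuous (by fun_prop)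
  obtain ⟨κ, hκ, h⟩ := Metric.uniformContinuous_iff.mp hc (δ / 2) (by positivity)
  -- With this value the three bad sets cost at most `3δ²/16`, leaving room for the `(δ/2)²` from
  -- the good coordinates.
  refine ⟨κ * δ / (4 * (D + 1)), by positivity, fun d hd K σ x hx y hy z hz => ?_⟩
  set δ' := κ * δ / (4 * (D + 1)) with hδ'
  have hβ : δ' ^ 2 / κ ^ 2 * D ^ 2 ≤ δ ^ 2 / 16 := by
    have e1 : δ' ^ 2 / κ ^ 2 * D ^ 2 = δ ^ 2 / 16 * (D / (D + 1)) ^ 2 := by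
      rw [hδ']
      field_simp
      ring
    have e2 : D / (D + 1) ≤ 1 := (div_le_one (by positivity)).mpr (by linarith)
    have e3 : (D / (D + 1)) ^ 2 ≤ 1 := pow_le_one₀ (by positivity) e2
    rw [e1]
    exact mul_le_of_le_one_right (by positivity) e3
  refine mem_almostEquivariant_of_card_filter_le hd (κ := δ / 2) (β := 3 * (δ' ^ 2 / κ ^ 2)) hD hδ
    (by nlinarith [sq_pos_of_pos hδ]) fun s hs => ?_
  have hx' := card_filter_le_of_mem_almostEquivariant hx hs hκ
  have hy' := card_filter_le_of_mem_almostEquivariant hy hs hκ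
  have hz' := card_filter_le_of_mem_almostEquivariant hz hs hκ
  have hsub : (Finset.univ.filter fun j =>
      δ / 2 ≤ dist (s • (x j * (y j)⁻¹ * z j)) (x (σ s j) * (y (σ s j))⁻¹ * z (σ s j))) ⊆
      (Finset.univ.filter fun j => κ ≤ dist (s • x j) (x (σ s j))) ∪
      ((Finset.univ.filter fun j => κ ≤ dist (s • y j) (y (σ s j))) ∪
      (Finset.univ.filter fun j => κ ≤ dist (s • z j) (z (σ s j)))) := by
    intro j hj
    simp only [Finset.mem_union, Finset.mem_filter, Finset.mem_univ, true_and] at hj ⊢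
    by_contra! hcon
    refine not_lt.mpr hj ?_
    have := @h (s • x j, s • y j, s • z j) (x (σ s j), y (σ s j), z (σ s j)) (by
      simp only [Prod.dist_eq]
      exact max_lt hcon.1 (max_lt hcon.2.1 hcon.2.2))
    simpa [smul_mul', smul_inv'] using this
  have hcard := (Finset.card_le_card hsub).trans ((Finset.card_union_le _ _).trans
    (add_le_add le_rfl (Finset.card_union_le _ _)))
  have hcard' : ((Finset.univ.filter fun j =>
      δ / 2 ≤ dist (s • (x j * (y j)⁻¹ * z j))
        (x (σ s j) * (y (σ s j))⁻¹ * z (σ s j))).card : ℝ) ≤ _ := Nat.cast_le.mpr hcard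
  push_cast at hcard'
  linarith

end AlmostEquivariant

/-! ### Lower bound for the number of separated almost equivariant points -/

section LowerBound

/-- Pigeonhole: points of `E` with the same cells along `F \ T` are `P`-close there, so they must be
separated along `T`. -/
theorem exists_subset_separated_of_subset {G X : Type*} [Group X] [SMul G X] [DecidableEq G]
    {P : Set X} {M : ℕ} {cell : X → Fin M} (hcell : ∀ x y, cell x = cell y → x⁻¹ * y ∈ P)
    {F : Finset G} (T : Finset G) {E : Finset X}
    (hE : ∀ x ∈ E, ∀ y ∈ E, x ≠ y → ∃ g ∈ F, (g • x)⁻¹ * (g • y) ∉ P) :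
    ∃ E' ⊆ E, (∀ x ∈ E', ∀ y ∈ E', x ≠ y → ∃ g ∈ T, (g • x)⁻¹ * (g • y) ∉ P) ∧
      E.card ≤ M ^ (F \ T).card * E'.card := by
  classical
  let φ : X → ((F \ T : Finset G) → Fin M) := fun x g => cell ((g : G) • x)
  obtain ⟨b, -, hb⟩ := Finset.exists_max_image
    (Finset.univ : Finset ((F \ T : Finset G) → Fin M))
    (fun b => (E.filter fun x => φ x = b).card) ⟨φ 1, Finset.mem_univ _⟩
  refine ⟨E.filter fun x => φ x = b, Finset.filter_subset _ _, ?_, ?_⟩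
  · intro x hx y hy hxy
    obtain ⟨hxE, hxb⟩ := Finset.mem_filter.mp hx
    obtain ⟨hyE, hyb⟩ := Finset.mem_filter.mp hy
    obtain ⟨g, hg, hgP⟩ := hE x hxE y hyE hxy
    refine ⟨g, by_contra fun hgT => hgP (hcell _ _ ?_), hgP⟩
    exact congrFun (hxb.trans hyb.symm) ⟨g, Finset.mem_sdiff.mpr ⟨hg, hgT⟩⟩
  · rw [Finset.card_eq_sum_card_fiberwise (f := φ) (t := Finset.univ)
      (fun _ _ => Finset.mem_coe.mpr (Finset.mem_univ _))]
    refine (Finset.sum_le_card_nsmul _ _ _ hb).trans_eq ?_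
    simp

open Classical in
/-- The configuration that carries the orbit of `w τ` along each tile `τ` and is trivial off the
tiles. -/
noncomputable def tileConfig {G X : Type*} [Group X] [SMul G X] {d : ℕ}
    (σ : G → Equiv.Perm (Fin d)) (𝒯 : Finset (Tile G d)) (w : 𝒯 → X) : Fin d → X :=
  fun j => if h : ∃ q : 𝒯 × G, q.2 ∈ q.1.1.part ∧ σ q.2 q.1.1.center = j then
    h.choose.2 • w h.choose.1 else 1

variable {G : Type*} [Group G] {d : ℕ} {σ : G → Equiv.Perm (Fin d)} {F : ℕ → Finset G}
  {L : Finset G} {ε : ℝ} {N : Finset ℕ} {𝒯 : Finset (Tile G d)}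

theorem IsTiling.tileConfig_apply {X : Type*} [Group X] [SMul G X] (h : IsTiling σ F L ε N 𝒯)
    (hL : ∀ n ∈ N, F n ⊆ L) (w : 𝒯 → X) (τ : 𝒯) {t : G} (ht : t ∈ τ.1.part) :
    tileConfig σ 𝒯 w (σ t τ.1.center) = t • w τ := by
  classical
  have hex : ∃ q : 𝒯 × G, q.2 ∈ q.1.1.part ∧ σ q.2 q.1.1.center = σ t τ.1.center :=
    ⟨(τ, t), ht, rfl⟩
  have hτ : hex.choose.1 = τ := by
    by_contra hne
    exact Finset.disjoint_left.mp (h.disjoint _ hex.choose.1.2 _ τ.2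
      fun e => hne (Subtype.ext e))
      (Finset.mem_image.mpr ⟨_, hex.choose_spec.1, hex.choose_spec.2⟩)
      (Finset.mem_image.mpr ⟨t, ht, rfl⟩)
  have hspec := hex.choose_spec
  have ht' : hex.choose.2 = t := by
    rw [hτ] at hspec
    have hsub : τ.1.part ⊆ L := (h.part_subset _ τ.2).trans (hL _ (h.shape_mem _ τ.2))
    exact (mem_goodSet.mp (h.good _ τ.2)).2 _ (hsub hspec.1) _ (hsub ht) hspec.2
  rw [tileConfig, dif_pos hex, hτ, ht']

open Classical in
theorem IsTiling.card_sdiff_part_le (h : IsTiling σ F L ε N 𝒯) {τ : Tile G d} (hτ : τ ∈ 𝒯) :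
    ((F τ.shape \ τ.part).card : ℝ) ≤ ε * (F τ.shape).card := by
  have h1 := Finset.card_sdiff_add_card_eq_card (h.part_subset τ hτ)
  have h2 : ((F τ.shape \ τ.part).card : ℝ) + τ.part.card = (F τ.shape).card := by
    exact_mod_cast h1
  have := h.le_card τ hτ
  linarith

open Classical in
-- Equivariance can fail only off the tiles (`4ε`) or where `s * t` leaves the part, either by
-- leaving the shape or by landing in the discarded piece (`2ε` of a total shape size at most `2d`).
theorem IsTiling.card_filter_tileConfig_ne_le {X : Type*} [Group X] [MulAction G X]
    (h : IsTiling σ F L ε N 𝒯) (hε0 : 0 < ε) (hε : ε ≤ 1 / 2) (hL : ∀ n ∈ N, F n ⊆ L) {s : G}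
    (hs : s ∈ L)
    (hinv : ∀ n ∈ N, (((F n).filter fun f => s * f ∉ F n).card : ℝ) ≤ ε * (F n).card)
    (hreg : ((region σ 𝒯)ᶜ.card : ℝ) ≤ 4 * ε * d) (w : 𝒯 → X) :
    ((Finset.univ.filter fun j =>
      s • tileConfig σ 𝒯 w j ≠ tileConfig σ 𝒯 w (σ s j)).card : ℝ) ≤ 8 * ε * d := by
  have h1 : (Finset.univ.filter fun j =>
      s • tileConfig σ 𝒯 w j ≠ tileConfig σ 𝒯 w (σ s j)).card ≤ (region σ 𝒯)ᶜ.card +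
      ∑ τ ∈ 𝒯, (((F τ.shape).filter fun f => s * f ∉ F τ.shape).card +
        (F τ.shape \ τ.part).card) := by
    refine le_trans (Finset.card_le_card (t := (region σ 𝒯)ᶜ ∪ 𝒯.biUnion fun τ =>
      (τ.part.filter fun t => s * t ∉ τ.part).image fun t => σ t τ.center) ?_)
      ((Finset.card_union_le _ _).trans (add_le_add le_rfl (Finset.card_biUnion_le.trans
        (Finset.sum_le_sum fun τ hτ => Finset.card_image_le.trans ?_))))
    · intro j hj
      have hj := (Finset.mem_filter.mp hj).2
      by_cases hjr : j ∈ region σ 𝒯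
      · obtain ⟨τ, hτ, t, ht, rfl⟩ := mem_region.mp hjr
        refine Finset.mem_union_right _ (Finset.mem_biUnion.mpr ⟨τ, hτ, Finset.mem_image.mpr
          ⟨t, Finset.mem_filter.mpr ⟨ht, fun hst => hj ?_⟩, rfl⟩⟩)
        have htL := hL _ (h.shape_mem τ hτ) (h.part_subset τ hτ ht)
        rw [(mem_goodSet.mp (h.good τ hτ)).1 s hs t htL,
          h.tileConfig_apply hL w ⟨τ, hτ⟩ ht, h.tileConfig_apply hL w ⟨τ, hτ⟩ hst, mul_smul]
      · exact Finset.mem_union_left _ (Finset.mem_compl.mpr hjr)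
    · refine (Finset.card_le_card (t := ((F τ.shape).filter fun f => s * f ∉ F τ.shape) ∪
        ((F τ.shape \ τ.part).image fun f => s⁻¹ * f)) fun t ht => ?_).trans
        ((Finset.card_union_le _ _).trans (add_le_add le_rfl Finset.card_image_le))
      obtain ⟨ht, hst⟩ := Finset.mem_filter.mp ht
      by_cases hF : s * t ∈ F τ.shape
      · exact Finset.mem_union_right _ (Finset.mem_image.mpr
          ⟨s * t, Finset.mem_sdiff.mpr ⟨hF, hst⟩, by simp⟩)
      · exact Finset.mem_union_left _ (Finset.mem_filter.mpr ⟨h.part_subset τ hτ ht, hF⟩)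
  have h2 : ((Finset.univ.filter fun j =>
      s • tileConfig σ 𝒯 w j ≠ tileConfig σ 𝒯 w (σ s j)).card : ℝ) ≤ _ := Nat.cast_le.mpr h1
  push_cast at h2
  have h3 : ∑ τ ∈ 𝒯, ((((F τ.shape).filter fun f => s * f ∉ F τ.shape).card : ℝ) +
      ((F τ.shape \ τ.part).card : ℝ)) ≤ ∑ τ ∈ 𝒯, (2 * ε) * ((F τ.shape).card : ℝ) :=
    Finset.sum_le_sum fun τ hτ => by
      have := hinv _ (h.shape_mem τ hτ)
      have := h.card_sdiff_part_le hτ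
      linarith
  rw [← Finset.mul_sum] at h3
  have h4 := h.sum_card_shape_le hL
  have h5 : (0 : ℝ) ≤ ∑ τ ∈ 𝒯, ((F τ.shape).card : ℝ) := by positivity
  have h6 : ∑ τ ∈ 𝒯, ((F τ.shape).card : ℝ) ≤ 2 * d := by nlinarith
  have h7 : (2 * ε) * ∑ τ ∈ 𝒯, ((F τ.shape).card : ℝ) ≤ (2 * ε) * (2 * d) :=
    mul_le_mul_of_nonneg_left h6 (by positivity)
  linarith

/-- Orbit-separated sets attached to the shapes combine to separated configurations. -/
theorem IsTiling.exists_separated {X : Type*} [Group X] [SMul G X] {P : Set X} (hP : (1 : X) ∈ P)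
    {M : ℕ} {cell : X → Fin M} (hcell : ∀ x y, cell x = cell y → x⁻¹ * y ∈ P)
    (h : IsTiling σ F L ε N 𝒯) (hε0 : 0 < ε) (hL : ∀ n ∈ N, F n ⊆ L)
    (hreg : ((region σ 𝒯)ᶜ.card : ℝ) ≤ 4 * ε * d) {a : ℝ} (ha : ε * Real.log M ≤ a)
    {E : ℕ → Finset X}
    (hE : ∀ n ∈ N, ∀ x ∈ E n, ∀ y ∈ E n, x ≠ y → ∃ g ∈ F n, (g • x)⁻¹ * (g • y) ∉ P)
    (hEcard : ∀ n ∈ N, Real.exp (a * (F n).card) ≤ (E n).card) :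
    ∃ E' : Finset (Fin d → X), (∀ x ∈ E', ∃ w : 𝒯 → X, x = tileConfig σ 𝒯 w) ∧
      (∀ x ∈ E', ∀ y ∈ E', x ≠ y → ∃ j, (x j)⁻¹ * y j ∉ P) ∧
      Real.exp ((a - ε * (Real.log M + 4 * a)) * d) ≤ E'.card := by
  classical
  have hM : (1 : ℝ) ≤ M := by
    have : 0 < M := (cell 1).pos
    exact_mod_cast this
  have hlogM : 0 ≤ Real.log M := Real.log_nonneg hM
  -- Restricting to the part of each tile costs `ε log M` in the rate; the further `4εa` comes from
  -- the uncovered coordinates.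
  have hsel : ∀ τ : 𝒯, ∃ D : Finset X,
      (∀ x ∈ D, ∀ y ∈ D, x ≠ y → ∃ g ∈ τ.1.part, (g • x)⁻¹ * (g • y) ∉ P) ∧
      Real.exp ((a - ε * Real.log M) * (F τ.1.shape).card) ≤ D.card := by
    intro τ
    have hmem := h.shape_mem τ τ.2
    obtain ⟨D, -, hD, hDcard⟩ := exists_subset_separated_of_subset hcell τ.1.part
      (hE _ hmem)
    refine ⟨D, hD, ?_⟩
    have h1 : Real.exp (a * (F τ.1.shape).card) ≤
        (M : ℝ) ^ (F τ.1.shape \ τ.1.part).card * D.card :=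
      (hEcard _ hmem).trans (by exact_mod_cast hDcard)
    have h2 : (M : ℝ) ^ (F τ.1.shape \ τ.1.part).card ≤
        Real.exp (ε * (F τ.1.shape).card * Real.log M) := by
      rw [← Real.rpow_natCast, Real.rpow_def_of_pos (by linarith), Real.exp_le_exp, mul_comm]
      exact mul_le_mul_of_nonneg_right (h.card_sdiff_part_le τ.2) hlogM
    have h3 := h1.trans (mul_le_mul_of_nonneg_right h2 (Nat.cast_nonneg _))
    refine le_of_mul_le_mul_left ?_ (Real.exp_pos (ε * (F τ.1.shape).card * Real.log M))
    refine le_trans (le_of_eq ?_) h3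
    rw [← Real.exp_add]
    ring_nf
  choose D hD hDcard using hsel
  have hsep : ∀ w ∈ Fintype.piFinset D, ∀ w' ∈ Fintype.piFinset D, w ≠ w' →
      ∃ j, (tileConfig σ 𝒯 w j)⁻¹ * tileConfig σ 𝒯 w' j ∉ P := by
    intro w hw w' hw' hne
    obtain ⟨τ, hτ⟩ := Function.ne_iff.mp hne
    obtain ⟨g, hg, hgP⟩ := hD τ _ (Fintype.mem_piFinset.mp hw τ) _
      (Fintype.mem_piFinset.mp hw' τ) hτ
    refine ⟨σ g τ.1.center, ?_⟩
    rwa [h.tileConfig_apply hL w τ hg, h.tileConfig_apply hL w' τ hg]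
  refine ⟨(Fintype.piFinset D).image (tileConfig σ 𝒯), ?_, ?_, ?_⟩
  · intro x hx
    obtain ⟨w, -, rfl⟩ := Finset.mem_image.mp hx
    exact ⟨w, rfl⟩
  · intro x hx y hy hxy
    obtain ⟨w, hw, rfl⟩ := Finset.mem_image.mp hx
    obtain ⟨w', hw', rfl⟩ := Finset.mem_image.mp hy
    exact hsep w hw w' hw' fun e => hxy (by rw [e])
  · rw [Finset.card_image_of_injOn, Fintype.card_piFinset]
    · push_cast
      refine le_trans ?_ (Finset.prod_le_prod (fun _ _ => (Real.exp_pos _).le)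
        fun τ _ => hDcard τ)
      rw [← Real.exp_sum, Real.exp_le_exp, ← Finset.mul_sum,
        Finset.sum_coe_sort 𝒯 fun τ => ((F τ.shape).card : ℝ)]
      have h1 := h.card_region_le_sum hL
      have h2 : ((region σ 𝒯).card : ℝ) + ((region σ 𝒯)ᶜ.card : ℝ) = d := by
        have := Finset.card_add_card_compl (region σ 𝒯)
        rw [Fintype.card_fin] at this
        exact_mod_cast this
      have h3 : (1 - 4 * ε) * d ≤ ∑ τ ∈ 𝒯, ((F τ.shape).card : ℝ) := by linarith
      refine le_trans ?_ (mul_le_mul_of_nonneg_left h3 (by linarith))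
      have : 0 ≤ ε ^ 2 * Real.log M * d := by positivity
      nlinarith
    · intro w hw w' hw' heq
      by_contra hne
      obtain ⟨j, hj⟩ := hsep w hw w' hw' hne
      rw [heq, inv_mul_cancel] at hj
      exact hj hP

theorem eventually_exists_separated {X : Type*} [MetricSpace X] [CompactSpace X] [Group X]
    [IsTopologicalGroup X] [MulDistribMulAction G X] (S : SoficApproximation G)
    (hF : IsFolnerSequence F) {P : Set X} (hP : P ∈ 𝓝 (1 : X)) {a : ℝ}
    (h : ∃ᶠ n in atTop, ∃ E : Finset X,
      (∀ x ∈ E, ∀ y ∈ E, x ≠ y → ∃ g ∈ F n, (g • x)⁻¹ * (g • y) ∉ P) ∧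
      Real.exp (a * (F n).card) ≤ E.card) {c : ℝ} (hc : 0 < c) (K : Finset G) {δ : ℝ}
    (hδ : 0 < δ) :
    ∀ᶠ i in atTop, ∃ E : Finset (Fin (S.d i) → X),
      (E : Set (Fin (S.d i) → X)) ⊆ almostEquivariant K δ (S.σ i) ∧
      (∀ x ∈ E, ∀ y ∈ E, x ≠ y → ∃ j, (x j)⁻¹ * y j ∉ P) ∧
      Real.exp ((a - c) * S.d i) ≤ E.card := by
  classical
  obtain ⟨D, hD⟩ : ∃ D, ∀ a b : X, dist a b ≤ D :=
    ⟨_, fun a b => Metric.dist_le_diam_of_mem (isCompact_univ.isBounded) (Set.mem_univ a)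
      (Set.mem_univ b)⟩
  -- For `a ≤ c` the target is at most 1 and the identity configuration suffices; afterwards `a` is
  -- positive.
  rcases le_or_gt a c with hac | hac
  · refine Eventually.of_forall fun i => ⟨{fun _ => 1}, ?_, ?_, ?_⟩
    · rw [Finset.coe_singleton, Set.singleton_subset_iff]
      refine mem_almostEquivariant_of_card_filter_le (S.d_pos i) (κ := δ / 2) (β := 0) hD hδ
        (by nlinarith) fun s _ => ?_
      simp [hδ]
    · intro x hx y hy hxy
      exact absurd ((Finset.mem_singleton.mp hx).trans (Finset.mem_singleton.mp hy).symm) hxy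
    · simp only [Finset.card_singleton, Nat.cast_one]
      refine Real.exp_le_one_iff.mpr (mul_nonpos_of_nonpos_of_nonneg (by linarith)
        (Nat.cast_nonneg _))
  obtain ⟨M, cell, hcell⟩ := exists_cell hP
  have hlogM : 0 ≤ Real.log M := Real.log_natCast_nonneg M
  obtain ⟨ε, hε0, hε, hεD, hεc⟩ : ∃ ε : ℝ, 0 < ε ∧ ε ≤ 1 / 2 ∧
      16 * ε * D ^ 2 ≤ δ ^ 2 ∧ ε * (Real.log M + 4 * a) ≤ c := by
    have hpos : 0 < Real.log M + 4 * a := by linarith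
    refine ⟨min (1 / 2) (min (δ ^ 2 / (16 * (D ^ 2 + 1))) (c / (Real.log M + 4 * a))),
      by positivity, min_le_left _ _, ?_, ?_⟩
    · have h1 : min (1 / 2) (min (δ ^ 2 / (16 * (D ^ 2 + 1))) (c / (Real.log M + 4 * a))) ≤
          δ ^ 2 / (16 * (D ^ 2 + 1)) := (min_le_right _ _).trans (min_le_left _ _)
      rw [le_div_iff₀ (by positivity)] at h1
      have h0 : 0 < min (1 / 2) (min (δ ^ 2 / (16 * (D ^ 2 + 1))) (c / (Real.log M + 4 * a))) := by
        positivity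
      linarith
    · rw [← le_div_iff₀ hpos]
      exact (min_le_right _ _).trans (min_le_right _ _)
  -- Inverses are taken because gluing needs invariance under `s`, whereas the tiling lemma is
  -- phrased with `s⁻¹`.
  obtain ⟨N, hN, htile⟩ := hF.exists_quasiTiling h hε0 hε (K.image fun s => s⁻¹)
  choose! E hE using fun n hn => (hN n hn).1
  filter_upwards [eventually_goodSet S (K ∪ N.biUnion F) hε0] with i hi
  have hL : ∀ n ∈ N, F n ⊆ K ∪ N.biUnion F := fun n hn =>
    (Finset.subset_biUnion_of_mem F hn).trans Finset.subset_union_right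
  obtain ⟨𝒯, h𝒯, hreg⟩ := htile _ hL _ _ hi
  obtain ⟨E', h1, h2, h3⟩ := h𝒯.exists_separated (mem_of_mem_nhds hP) hcell hε0 hL hreg
    (a := a) (by nlinarith) (fun n hn => (hE n hn).1) (fun n hn => (hE n hn).2)
  refine ⟨E', fun x hx => ?_, h2, le_trans (Real.exp_le_exp.mpr ?_) h3⟩
  · obtain ⟨w, rfl⟩ := h1 x hx
    refine mem_almostEquivariant_of_card_filter_le (S.d_pos i) (κ := δ / 2) (β := 8 * ε) hD hδ
      (by nlinarith [sq_pos_of_pos hδ]) fun s hs => ?_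
    refine le_trans (Nat.cast_le.mpr (Finset.card_le_card fun j hj => ?_))
      (h𝒯.card_filter_tileConfig_ne_le hε0 hε hL (Finset.mem_union_left _ hs)
        (fun n hn => ?_) hreg w)
    · refine Finset.mem_filter.mpr ⟨Finset.mem_univ _, fun heq => ?_⟩
      have := (Finset.mem_filter.mp hj).2
      rw [heq, dist_self] at this
      linarith
    · simpa using (hN n hn).2 s⁻¹ (Finset.mem_image_of_mem _ hs)
  · exact mul_le_mul_of_nonneg_right (by linarith) (Nat.cast_nonneg _)

end LowerBound

/-! ### Upper bound for the number of separated almost equivariant points -/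

section UpperBound

/-- A Chernoff-type count: give every marked coordinate weight `t`. The total weight is `(1 + M * t)
^ d`, and each counted `f` weighs at least `t ^ (β * d)`. -/
theorem card_filter_card_ne_none_le {M d : ℕ} {t β : ℝ} (ht : 0 < t) (ht1 : t ≤ 1) :
    ((Finset.univ.filter fun f : Fin d → Option (Fin M) =>
      ((Finset.univ.filter fun j => f j ≠ none).card : ℝ) ≤ β * d).card : ℝ) ≤
      Real.exp ((M * t - β * Real.log t) * d) := by
  classical
  have h1 : ∑ f : Fin d → Option (Fin M), ∏ j, (if f j ≠ none then t else 1) =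
      (1 + M * t) ^ d := by
    rw [← Fintype.sum_pow (fun o : Option (Fin M) => if o ≠ none then t else 1) d]
    simp [Fintype.sum_option]
  have h2 : ∀ f : Fin d → Option (Fin M),
      ((Finset.univ.filter fun j => f j ≠ none).card : ℝ) ≤ β * d →
      Real.exp (β * d * Real.log t) ≤ ∏ j, (if f j ≠ none then t else 1) := by
    intro f hf
    rw [Finset.prod_ite, Finset.prod_const, Finset.prod_const_one, mul_one,
      ← Real.rpow_natCast, Real.rpow_def_of_pos ht, Real.exp_le_exp, mul_comm]
    exact mul_le_mul_of_nonpos_left hf (Real.log_nonpos ht.le ht1)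
  set B := Finset.univ.filter fun f : Fin d → Option (Fin M) =>
    ((Finset.univ.filter fun j => f j ≠ none).card : ℝ) ≤ β * d
  have h3 : (B.card : ℝ) * Real.exp (β * d * Real.log t) ≤ (1 + M * t) ^ d := by
    rw [← h1, ← nsmul_eq_mul]
    refine (Finset.card_nsmul_le_sum B _ _ fun f hf => h2 f (Finset.mem_filter.mp hf).2).trans
      (Finset.sum_le_sum_of_subset_of_nonneg (Finset.subset_univ _) fun f _ _ => ?_)
    exact Finset.prod_nonneg fun j _ => by split_ifs <;> linarith
  have h4 : (1 + M * t) ^ d ≤ Real.exp (M * t * d) := by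
    rw [mul_comm _ (d : ℝ), Real.exp_nat_mul]
    refine pow_le_pow_left₀ (by positivity) ?_ d
    rw [add_comm]
    exact Real.add_one_le_exp _
  refine le_of_mul_le_mul_right ?_ (Real.exp_pos (β * d * Real.log t))
  refine (h3.trans h4).trans_eq ?_
  rw [← Real.exp_add]
  ring_nf

variable {G : Type*} [Group G] {F : ℕ → Finset G}

theorem IsTiling.sum_card_shape_le_mul {d : ℕ} {σ : G → Equiv.Perm (Fin d)} {L : Finset G}
    {ε : ℝ} {N : Finset ℕ} {𝒯 : Finset (Tile G d)} (h : IsTiling σ F L ε N 𝒯) (hε0 : 0 ≤ ε)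
    (hε : ε ≤ 1 / 2) (hL : ∀ n ∈ N, F n ⊆ L) :
    ∑ τ ∈ 𝒯, ((F τ.shape).card : ℝ) ≤ (1 + 2 * ε) * d := by
  have h2 := h.sum_card_shape_le hL
  have h3 : (0 : ℝ) ≤ ∑ τ ∈ 𝒯, ((F τ.shape).card : ℝ) := by positivity
  have h5 : (1 + 2 * ε) * ((1 - ε) * ∑ τ ∈ 𝒯, ((F τ.shape).card : ℝ)) ≤ (1 + 2 * ε) * d :=
    mul_le_mul_of_nonneg_left h2 (by linarith)
  have h6 : 0 ≤ (ε * (1 - 2 * ε)) * ∑ τ ∈ 𝒯, ((F τ.shape).card : ℝ) :=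
    mul_nonneg (mul_nonneg hε0 (by linarith)) h3
  linarith

/-- A point is encoded by the codes of its tile centers and by cells at exceptional coordinates.
Elsewhere, equal codes give `x j ≈ g • x c ≈ g • y c ≈ y j` with `c` the tile center, three
`P'`-steps that combine to one `P`-step; so the encoding is injective on separated sets. -/
theorem IsTiling.card_separated_le {X : Type*} [MetricSpace X] [Group X] [MulAction G X] {d : ℕ}
    {σ : G → Equiv.Perm (Fin d)} {L : Finset G} {ε : ℝ} {N : Finset ℕ} {𝒯 : Finset (Tile G d)}
    (h : IsTiling σ F L ε N 𝒯) (hε : ε ≤ 1 / 2) (hL : ∀ n ∈ N, F n ⊆ L)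
    (hreg : ((region σ 𝒯)ᶜ.card : ℝ) ≤ 4 * ε * d) {P P' : Set X}
    (hPP : ∀ p ∈ P', ∀ q ∈ P', ∀ r ∈ P', p * q * r ∈ P)
    {Q : ℕ} {cell : X → Fin Q} (hcell : ∀ x y, cell x = cell y → x⁻¹ * y ∈ P)
    {κ : ℝ} (hκ0 : 0 < κ) (hκ : ∀ x y : X, dist x y < κ → x⁻¹ * y ∈ P')
    {a : ℝ} (ha : 0 ≤ a) {M : ℕ → ℕ} {code : ℕ → X → ℕ} (hM : ∀ n ∈ N, ∀ x, code n x < M n)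
    (hcode : ∀ n ∈ N, ∀ x y, code n x = code n y → ∀ g ∈ F n, (g • x)⁻¹ * (g • y) ∈ P')
    (hMa : ∀ n ∈ N, (M n : ℝ) ≤ Real.exp (a * (F n).card))
    {K : Finset G} (hK : ∀ n ∈ N, F n ⊆ K) {δ : ℝ} (hδ : K.card * (δ ^ 2 / κ ^ 2) ≤ ε)
    {t : ℝ} (ht : 0 < t) (ht1 : t ≤ 1) {E : Finset (Fin d → X)}
    (hEK : (E : Set (Fin d → X)) ⊆ almostEquivariant K δ σ)
    (hE : ∀ x ∈ E, ∀ y ∈ E, x ≠ y → ∃ j, (x j)⁻¹ * y j ∉ P) :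
    (E.card : ℝ) ≤ Real.exp ((a * (1 + 2 * ε) + (Q * t - 5 * ε * Real.log t)) * d) := by
  classical
  have hex : ∀ j, ∃ q : Tile G d × G, j ∈ region σ 𝒯 →
      q.1 ∈ 𝒯 ∧ q.2 ∈ q.1.part ∧ σ q.2 q.1.center = j := by
    intro j
    by_cases hj : j ∈ region σ 𝒯
    · obtain ⟨τ, hτ, t, ht, hj'⟩ := mem_region.mp hj
      exact ⟨(τ, t), fun _ => ⟨hτ, ht, hj'⟩⟩
    · exact ⟨(⟨j, 0, ∅⟩, 1), fun hj' => absurd hj' hj⟩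
  choose q hq using hex
  -- The value `none` marks a coordinate recovered from its tile center. The others have density at
  -- most `5ε`: `4ε` off the tiles and `ε` from failures of equivariance.
  let f : (Fin d → X) → Fin d → Option (Fin Q) := fun x j =>
    if j ∈ region σ 𝒯 ∧ dist ((q j).2 • x (q j).1.center) (x j) < κ then none else some (cell (x j))
  let φ : (Fin d → X) → (𝒯 → ℕ) × (Fin d → Option (Fin Q)) := fun x =>
    (fun τ => code τ.1.shape (x τ.1.center), f x)
  have hmaps : ∀ x ∈ E, φ x ∈ (Fintype.piFinset fun τ : 𝒯 => Finset.range (M τ.1.shape)) ×ˢ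
      (Finset.univ.filter fun f : Fin d → Option (Fin Q) =>
        ((Finset.univ.filter fun j => f j ≠ none).card : ℝ) ≤ 5 * ε * d) := by
    intro x hx
    refine Finset.mem_product.mpr ⟨Fintype.mem_piFinset.mpr fun τ => Finset.mem_range.mpr
      (hM _ (h.shape_mem _ τ.2) _), Finset.mem_filter.mpr ⟨Finset.mem_univ _, ?_⟩⟩
    have h1 : (Finset.univ.filter fun j => f x j ≠ none) ⊆ (region σ 𝒯)ᶜ ∪ K.biUnion fun s =>
        (Finset.univ.filter fun j => κ ≤ dist (s • x j) (x (σ s j))).image (σ s) := by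
      intro j hj
      have hj := (Finset.mem_filter.mp hj).2
      by_cases hjr : j ∈ region σ 𝒯
      · obtain ⟨hτ, ht, hj'⟩ := hq j hjr
        refine Finset.mem_union_right _ (Finset.mem_biUnion.mpr ⟨(q j).2,
          hK _ (h.shape_mem _ hτ) (h.part_subset _ hτ ht), Finset.mem_image.mpr
          ⟨(q j).1.center, Finset.mem_filter.mpr ⟨Finset.mem_univ _, ?_⟩, hj'⟩⟩)
        rw [hj']
        by_contra hlt
        exact hj (if_pos ⟨hjr, not_le.mp hlt⟩)
      · exact Finset.mem_union_left _ (Finset.mem_compl.mpr hjr)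
    have h2 := (Finset.card_le_card h1).trans ((Finset.card_union_le _ _).trans
      (add_le_add le_rfl (Finset.card_biUnion_le.trans
        (Finset.sum_le_sum fun s _ => Finset.card_image_le))))
    have h3 : ((Finset.univ.filter fun j => f x j ≠ none).card : ℝ) ≤ _ := Nat.cast_le.mpr h2
    push_cast at h3
    have h4 : ∑ s ∈ K, ((Finset.univ.filter fun j => κ ≤ dist (s • x j) (x (σ s j))).card : ℝ) ≤
        ∑ s ∈ K, δ ^ 2 / κ ^ 2 * d := Finset.sum_le_sum fun s hs =>
      card_filter_le_of_mem_almostEquivariant (hEK hx) hs hκ0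
    rw [Finset.sum_const, nsmul_eq_mul, ← mul_assoc] at h4
    have h5 := mul_le_mul_of_nonneg_right hδ (Nat.cast_nonneg d)
    linarith
  have hinj : Set.InjOn φ E := by
    intro x hx y hy hxy
    by_contra hne
    obtain ⟨j, hj⟩ := hE x hx y hy hne
    have hfj : f x j = f y j := congrFun (congrArg Prod.snd hxy) j
    have hc : ∀ τ : 𝒯, code τ.1.shape (x τ.1.center) = code τ.1.shape (y τ.1.center) :=
      fun τ => congrFun (congrArg Prod.fst hxy) τ
    apply hj
    by_cases hxj : j ∈ region σ 𝒯 ∧ dist ((q j).2 • x (q j).1.center) (x j) < κ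
    · by_cases hyj : j ∈ region σ 𝒯 ∧ dist ((q j).2 • y (q j).1.center) (y j) < κ
      · obtain ⟨hτ, ht, -⟩ := hq j hxj.1
        have e := hPP _ (hκ _ _ ((dist_comm _ _).trans_lt hxj.2)) _
          (hcode _ (h.shape_mem _ hτ) _ _ (hc ⟨(q j).1, hτ⟩) _ (h.part_subset _ hτ ht)) _
          (hκ _ _ hyj.2)
        simpa [mul_assoc] using e
      · simp only [f, if_pos hxj, if_neg hyj] at hfj
        exact absurd hfj (by simp)
    · by_cases hyj : j ∈ region σ 𝒯 ∧ dist ((q j).2 • y (q j).1.center) (y j) < κ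
      · simp only [f, if_neg hxj, if_pos hyj] at hfj
        exact absurd hfj (by simp)
      · simp only [f, if_neg hxj, if_neg hyj] at hfj
        exact hcell _ _ (Option.some.inj hfj)
  have hcard := Finset.card_le_card_of_injOn φ hmaps hinj
  rw [Finset.card_product, Fintype.card_piFinset] at hcard
  have h1 : (E.card : ℝ) ≤ _ := Nat.cast_le.mpr hcard
  push_cast at h1
  simp only [Finset.card_range] at h1
  refine h1.trans ?_
  rw [add_mul, Real.exp_add]
  refine mul_le_mul ?_ (card_filter_card_ne_none_le ht ht1) (Nat.cast_nonneg _)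
    (Real.exp_pos _).le
  refine (Finset.prod_le_prod (fun _ _ => Nat.cast_nonneg _)
    fun τ _ => hMa _ (h.shape_mem _ τ.2)).trans ?_
  rw [← Real.exp_sum, Real.exp_le_exp, ← Finset.mul_sum,
    Finset.sum_coe_sort 𝒯 fun τ => ((F τ.shape).card : ℝ), mul_assoc]
  refine mul_le_mul_of_nonneg_left ?_ ha
  exact h.sum_card_shape_le_mul
    ((mul_nonneg (Nat.cast_nonneg _) (div_nonneg (sq_nonneg _) (sq_nonneg _))).trans hδ) hε hL

theorem eventually_card_separated_le {X : Type*} [MetricSpace X] [CompactSpace X] [Group X]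
    [IsTopologicalGroup X] [MulDistribMulAction G X] (S : SoficApproximation G)
    (hF : IsFolnerSequence F) {P P' : Set X} (hP : P ∈ 𝓝 (1 : X)) (hP' : P' ∈ 𝓝 (1 : X))
    (hPP : ∀ p ∈ P', ∀ q ∈ P', ∀ r ∈ P', p * q * r ∈ P) {a : ℝ} (ha : 0 ≤ a)
    (h : ∃ᶠ n in atTop, ∃ (M : ℕ) (code : X → ℕ), (∀ x, code x < M) ∧
      (∀ x y, code x = code y → ∀ g ∈ F n, (g • x)⁻¹ * (g • y) ∈ P') ∧
      (M : ℝ) ≤ Real.exp (a * (F n).card)) {c : ℝ} (hc : 0 < c) :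
    ∃ K : Finset G, K.Nonempty ∧ ∃ δ > 0, ∀ᶠ i in atTop, ∀ E : Finset (Fin (S.d i) → X),
      (E : Set (Fin (S.d i) → X)) ⊆ almostEquivariant K δ (S.σ i) →
      (∀ x ∈ E, ∀ y ∈ E, x ≠ y → ∃ j, (x j)⁻¹ * y j ∉ P) →
      (E.card : ℝ) ≤ Real.exp ((a + c) * S.d i) := by
  classical
  obtain ⟨Q, cell, hcell⟩ := exists_cell hP
  obtain ⟨κ, hκ0, hκ⟩ := exists_forall_dist_lt_inv_mul_mem hP'
  -- The order matters: `t` is fixed first to make `Q * t` small, then `ε` is taken small against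
  -- `-log t`.
  obtain ⟨t, ht, ht1, htc⟩ : ∃ t : ℝ, 0 < t ∧ t ≤ 1 ∧ Q * t ≤ c / 3 := by
    refine ⟨min 1 (c / (3 * (Q + 1))), by positivity, min_le_left _ _, ?_⟩
    have h1 : min 1 (c / (3 * ((Q : ℝ) + 1))) ≤ c / (3 * (Q + 1)) := min_le_right _ _
    rw [le_div_iff₀ (by positivity)] at h1
    have h0 : 0 < min 1 (c / (3 * ((Q : ℝ) + 1))) := by positivity
    linarith
  have hlog : 0 ≤ -Real.log t := by linarith [Real.log_nonpos ht.le ht1]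
  obtain ⟨ε, hε0, hε, hεc⟩ : ∃ ε : ℝ, 0 < ε ∧ ε ≤ 1 / 2 ∧
      ε * (2 * a + 5 * -Real.log t) ≤ 2 * c / 3 := by
    refine ⟨min (1 / 2) (2 * c / (3 * (2 * a + 5 * -Real.log t + 1))), by positivity,
      min_le_left _ _, ?_⟩
    have h1 : min (1 / 2) (2 * c / (3 * (2 * a + 5 * -Real.log t + 1))) ≤
      2 * c / (3 * (2 * a + 5 * -Real.log t + 1)) := min_le_right _ _
    rw [le_div_iff₀ (by positivity)] at h1
    have h0 : 0 < min (1 / 2) (2 * c / (3 * (2 * a + 5 * -Real.log t + 1))) := by positivity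
    linarith
  obtain ⟨N, hN, htile⟩ := hF.exists_quasiTiling h hε0 hε ∅
  choose! M code hcode using fun n hn => (hN n hn).1
  set K := insert 1 (N.biUnion F) with hK
  have hL : ∀ n ∈ N, F n ⊆ K := fun n hn =>
    (Finset.subset_biUnion_of_mem F hn).trans (Finset.subset_insert _ _)
  have hKpos : (0 : ℝ) < K.card := by
    exact_mod_cast Finset.card_pos.mpr (Finset.insert_nonempty _ _)
  refine ⟨K, Finset.insert_nonempty _ _, κ * Real.sqrt (ε / K.card), by positivity, ?_⟩
  filter_upwards [eventually_goodSet S K hε0] with i hi E hEK hE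
  obtain ⟨𝒯, h𝒯, hreg⟩ := htile K hL _ _ hi
  refine (h𝒯.card_separated_le hε hL hreg hPP hcell hκ0 hκ ha (fun n hn => (hcode n hn).1)
    (fun n hn => (hcode n hn).2.1) (fun n hn => (hcode n hn).2.2) hL (le_of_eq ?_) ht ht1 hEK
    hE).trans (Real.exp_le_exp.mpr (mul_le_mul_of_nonneg_right ?_ (Nat.cast_nonneg _)))
  · rw [mul_pow, Real.sq_sqrt (by positivity)]
    field_simp
  · linarith

end UpperBound

/-! ### Entropy in terms of separated sets -/

section Bridge

theorem exists_symm_nhds_one_mul_mul {X : Type*} [TopologicalSpace X] [Group X]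
    [IsTopologicalGroup X] {P : Set X} (hP : P ∈ 𝓝 (1 : X)) :
    ∃ V ∈ 𝓝 (1 : X), (∀ p ∈ V, p⁻¹ ∈ V) ∧ ∀ p ∈ V, ∀ q ∈ V, ∀ r ∈ V, p * q * r ∈ P := by
  obtain ⟨V, hV, h⟩ := exists_nhds_one_split4 hP
  refine ⟨V ∩ V⁻¹, Filter.inter_mem hV (inv_mem_nhds_one X hV), fun p hp => ⟨hp.2, ?_⟩,
    fun p hp q hq r hr => ?_⟩
  · simpa using hp.1
  · simpa using h hp.1 hq.1 hr.1 (mem_of_mem_nhds hV)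

variable {G X : Type*} [Group G]

theorem frequently_exists_separated_of_lt_amenableCondEntropy [Group X] [MulAction G X]
    {F : ℕ → Finset G} (hF : IsFolnerSequence F) {U W : Set (Set X)} {P : Set X}
    (hP1 : (1 : X) ∈ P) (hPinv : ∀ p ∈ P, p⁻¹ ∈ P) (hPU : ∀ x : X, ∃ u ∈ U, ∀ p ∈ P, x * p ∈ u)
    {a : ℝ} (ha : (a : EReal) < amenableCondEntropy F U W) :
    ∃ᶠ n in atTop, ∃ E : Finset X,
      (∀ x ∈ E, ∀ y ∈ E, x ≠ y → ∃ g ∈ F n, (g • x)⁻¹ * (g • y) ∉ P) ∧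
      Real.exp (a * (F n).card) ≤ E.card := by
  refine (frequently_lt_of_lt_limsup (by isBoundedDefault) ha).mono fun n hn => ?_
  by_contra! hcon
  have hcard : 0 < (F n).card := Finset.card_pos.mpr (hF.nonempty n)
  have hcard' : (0 : ℝ) < (F n).card := by exact_mod_cast hcard
  refine not_le.mpr hn ?_
  rw [EReal.div_le_iff_le_mul (by exact_mod_cast hcard') (EReal.coe_ne_top _)]
  refine iSup₂_le fun K _ => ?_
  rw [← EReal.div_le_iff_le_mul (by exact_mod_cast hcard') (EReal.coe_ne_top _)]
  refine logCard_div_le hcard (M := ⌊Real.exp (a * (F n).card)⌋₊) ?_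
    (Nat.floor_le (Real.exp_pos _).le)
  refine coverNumber_le_of_separated
    (R := fun x y => ∀ g ∈ F n, (g • x)⁻¹ * (g • y) ∈ P) ?_ ?_ ?_ fun E _ hE => ?_
  · intro y g _
    simpa using hP1
  · intro y z h g hg
    simpa using hPinv _ (h g hg)
  · intro y
    choose u huU hu using hPU
    refine ⟨⋂ g ∈ F n, (fun x : X => g • x) ⁻¹' u (g • y), ⟨fun g => u (g • y),
      fun g _ => huU _, rfl⟩, fun z hz => Set.mem_iInter₂.mpr fun g hg => ?_⟩
    simpa using hu (g • y) _ (hz g hg)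
  · refine Nat.le_floor (hcon E fun x hx y hy hxy => ?_).le
    simpa using hE x hx y hy hxy

/-- The code of `x` is the index of a member containing it in an economical subcover of the join. -/
theorem eventually_exists_code_of_amenableCondEntropy_lt [Group X] [MulAction G X]
    {F : ℕ → Finset G} (hF : IsFolnerSequence F) {U : Set (Set X)} {P : Set X}
    (hUP : ∀ u ∈ U, ∀ x ∈ u, ∀ y ∈ u, x⁻¹ * y ∈ P) {a : ℝ}
    (ha : amenableCondEntropy F U {Set.univ} < a) :
    ∀ᶠ n in atTop, ∃ (M : ℕ) (code : X → ℕ), (∀ x, code x < M) ∧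
      (∀ x y, code x = code y → ∀ g ∈ F n, (g • x)⁻¹ * (g • y) ∈ P) ∧
      (M : ℝ) ≤ Real.exp (a * (F n).card) := by
  filter_upwards [eventually_lt_of_limsup_lt ha (by isBoundedDefault)] with n hn
  have hcard : 0 < (F n).card := Finset.card_pos.mpr (hF.nonempty n)
  have huniv : (Set.univ : Set X) ∈ joinCover ({Set.univ} : Set (Set X)) (F n) :=
    ⟨fun _ => Set.univ, fun _ _ => rfl, by simp⟩
  have h1 : logCard (coverNumber (joinCover U (F n)) Set.univ) / (((F n).card : ℝ) : EReal) < a :=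
    (EReal.div_le_div_right_of_nonneg (by exact_mod_cast (Nat.cast_nonneg _))
      (le_iSup₂ (f := fun K (_ : K ∈ joinCover ({Set.univ} : Set (Set X)) (F n)) =>
        logCard (coverNumber (joinCover U (F n)) K)) Set.univ huniv)).trans_lt hn
  obtain ⟨M, hM, hMa⟩ := exists_le_exp_of_logCard_div_lt hcard h1
  obtain ⟨C, hCU, hC, hCfin, hCM⟩ := exists_subcover_of_coverNumber_le hM.le
  have hex : ∀ x : X, ∃ v : C, x ∈ (v : Set X) := fun x => by
    obtain ⟨v, hv, hxv⟩ := hC (Set.mem_univ x)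
    exact ⟨⟨v, hv⟩, hxv⟩
  choose v hv using hex
  have : Finite C := hCfin
  refine ⟨M, fun x => Finite.equivFin C (v x), fun x => lt_of_lt_of_le (Fin.is_lt _) ?_,
    fun x y hxy g hg => ?_, hMa⟩
  · rwa [Nat.card_coe_set_eq]
  · have he : v x = v y := (Finite.equivFin C).injective (Fin.ext hxy)
    obtain ⟨w, hw, hvw⟩ := hCU (v x).2
    have hx := hv x
    have hy := hv y
    rw [← he] at hy
    rw [hvw] at hx hy
    exact hUP _ (hw g hg) _ (Set.mem_iInter₂.mp hx g hg) _ (Set.mem_iInter₂.mp hy g hg)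

/-- There are at most `|U₂|^d` boxes, and a member of `powerCover U₁ d` contains at most one point
of `E`. -/
theorem card_le_of_coverNumber_le [Group X] {d M : ℕ} {U₁ U₂ : Set (Set X)} {P : Set X}
    (hU₁ : ∀ u ∈ U₁, ∀ x ∈ u, ∀ y ∈ u, x⁻¹ * y ∈ P) (hU₂ : U₂.Finite) (hU₂' : ⋃₀ U₂ = Set.univ)
    {Z : Set (Fin d → X)}
    (hM : ∀ V ∈ powerCover U₂ d, coverNumber (powerCover U₁ d) (Z ∩ V) ≤ M)
    {E : Finset (Fin d → X)} (hEZ : (E : Set (Fin d → X)) ⊆ Z)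
    (hE : ∀ x ∈ E, ∀ y ∈ E, x ≠ y → ∃ j, (x j)⁻¹ * y j ∉ P) :
    E.card ≤ U₂.ncard ^ d * M := by
  classical
  have h1 : ∀ u ∈ Fintype.piFinset fun _ : Fin d => hU₂.toFinset,
      (E.filter fun x => x ∈ Set.pi Set.univ u).card ≤ M := by
    intro u hu
    have hu' : ∀ j, u j ∈ U₂ := fun j => hU₂.mem_toFinset.mp (Fintype.mem_piFinset.mp hu j)
    obtain ⟨C, hCU, hC, hCfin, hCM⟩ := exists_subcover_of_coverNumber_le (hM _ ⟨u, hu', rfl⟩)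
    refine le_trans ?_ hCM
    have hex : ∀ x ∈ E.filter fun x => x ∈ Set.pi Set.univ u, ∃ v ∈ C, x ∈ v := fun x hx =>
      hC ⟨hEZ (Finset.mem_filter.mp hx).1, (Finset.mem_filter.mp hx).2⟩
    choose! v hvC hv using hex
    rw [Set.ncard_eq_toFinset_card C hCfin]
    refine Finset.card_le_card_of_injOn v (fun x hx => hCfin.mem_toFinset.mpr (hvC x hx)) ?_
    intro x hx y hy hxy
    by_contra hne
    obtain ⟨j, hj⟩ := hE x (Finset.mem_filter.mp hx).1 y (Finset.mem_filter.mp hy).1 hne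
    obtain ⟨w, hw, hvw⟩ := hCU (hvC x hx)
    have hx' := hv x hx
    have hy' := hv y hy
    rw [← hxy] at hy'
    rw [hvw] at hx' hy'
    exact hj (hU₁ _ (hw j) _ (hx' j (Set.mem_univ j)) _ (hy' j (Set.mem_univ j)))
  calc E.card ≤ ((Fintype.piFinset fun _ : Fin d => hU₂.toFinset).biUnion fun u =>
        E.filter fun x => x ∈ Set.pi Set.univ u).card := by
        refine Finset.card_le_card fun x hx => ?_
        have hex : ∀ j, ∃ u ∈ U₂, x j ∈ u := fun j => by
          have : x j ∈ ⋃₀ U₂ := hU₂' ▸ Set.mem_univ _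
          simpa using this
        choose u huU hu using hex
        exact Finset.mem_biUnion.mpr ⟨u, Fintype.mem_piFinset.mpr fun j =>
          hU₂.mem_toFinset.mpr (huU j), Finset.mem_filter.mpr ⟨hx, fun j _ => hu j⟩⟩
    _ ≤ (Fintype.piFinset fun _ : Fin d => hU₂.toFinset).card * M :=
        Finset.card_biUnion_le_card_mul _ _ _ h1
    _ = U₂.ncard ^ d * M := by
        rw [Fintype.card_piFinset_const, Set.ncard_eq_toFinset_card U₂ hU₂]

/-- Translating a separated set within a small cell by a coarsely separated set. -/
theorem card_mul_card_le [Group X] {d : ℕ} {O O' P : Set X} (hP1 : (1 : X) ∈ P)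
    (hO : ∀ p ∈ O', ∀ q ∈ P, ∀ r ∈ O', p * q * r⁻¹ ∈ O) {Z Z' : Set (Fin d → X)}
    (hZ : ∀ x ∈ Z', ∀ y ∈ Z', ∀ z ∈ Z', (fun j => x j * (y j)⁻¹ * z j) ∈ Z) {B : ℝ} (hB0 : 0 ≤ B)
    (hB : ∀ E : Finset (Fin d → X), (E : Set (Fin d → X)) ⊆ Z →
      (∀ x ∈ E, ∀ y ∈ E, x ≠ y → ∃ j, (x j)⁻¹ * y j ∉ P) → (E.card : ℝ) ≤ B)
    {E Q : Finset (Fin d → X)} (hEZ : (E : Set (Fin d → X)) ⊆ Z')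
    (hE : ∀ x ∈ E, ∀ y ∈ E, x ≠ y → ∃ j, (x j)⁻¹ * y j ∉ O)
    (hQZ : (Q : Set (Fin d → X)) ⊆ Z')
    (hQ : ∀ x ∈ Q, ∀ y ∈ Q, x ≠ y → ∃ j, (x j)⁻¹ * y j ∉ P)
    (hQO : ∀ x ∈ Q, ∀ y ∈ Q, ∀ j, (x j)⁻¹ * y j ∈ O') :
    (E.card : ℝ) * Q.card ≤ B := by
  classical
  rcases Q.eq_empty_or_nonempty with rfl | ⟨y₀, hy₀⟩
  · simpa using hB0
  let φ : (Fin d → X) × (Fin d → X) → Fin d → X := fun q j => q.1 j * (y₀ j)⁻¹ * q.2 j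
  have hsep : ∀ q ∈ E ×ˢ Q, ∀ q' ∈ E ×ˢ Q, q ≠ q' → ∃ j, (φ q j)⁻¹ * φ q' j ∉ P := by
    rintro ⟨x, y⟩ hq ⟨x', y'⟩ hq' hne
    obtain ⟨hx, hy⟩ := Finset.mem_product.mp hq
    obtain ⟨hx', hy'⟩ := Finset.mem_product.mp hq'
    by_cases hxx : x = x'
    · subst hxx
      have hyy : y ≠ y' := fun e => hne (by rw [e])
      obtain ⟨j, hj⟩ := hQ y hy y' hy' hyy
      refine ⟨j, fun hmem => hj ?_⟩
      simpa [φ, mul_assoc] using hmem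
    · obtain ⟨j, hj⟩ := hE x hx x' hx' hxx
      refine ⟨j, fun hmem => hj ?_⟩
      have := hO _ (hQO y₀ hy₀ y hy j) _ hmem _ (hQO y₀ hy₀ y' hy' j)
      simpa [φ, mul_assoc] using this
  have hinj : Set.InjOn φ (E ×ˢ Q : Finset _) := by
    intro q hq q' hq' heq
    by_contra hne
    obtain ⟨j, hj⟩ := hsep q hq q' hq' hne
    rw [heq, inv_mul_cancel] at hj
    exact hj hP1
  have h1 := hB ((E ×ˢ Q).image φ) ?_ ?_
  · rw [Finset.card_image_of_injOn hinj, Finset.card_product] at h1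
    exact_mod_cast h1
  · intro z hz
    obtain ⟨q, hq, rfl⟩ := Finset.mem_image.mp (Finset.mem_coe.mp hz)
    obtain ⟨hx, hy⟩ := Finset.mem_product.mp hq
    exact hZ _ (hEZ hx) _ (hQZ hy₀) _ (hQZ hy)
  · intro z hz z' hz' hne
    obtain ⟨q, hq, rfl⟩ := Finset.mem_image.mp hz
    obtain ⟨q', hq', rfl⟩ := Finset.mem_image.mp hz'
    exact hsep q hq q' hq' fun e => hne (by rw [e])

end Bridge

/-! ### The two implications -/

section Main

variable {G X : Type*} [Group G] [MetricSpace X] [CompactSpace X] [Group X]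
  [IsTopologicalGroup X] [MulDistribMulAction G X]

/-- A nonempty space needs at least one covering set. This excludes the value `-∞`, so that finite
entropy is a real number. -/
theorem zero_le_amenableTopEntropy {F : ℕ → Finset G} (hF : IsFolnerSequence F) :
    0 ≤ amenableTopEntropy F X := by
  obtain ⟨U, hU, hUP⟩ := exists_small_cover (X := X) Filter.univ_mem
  refine le_trans ?_ (le_iSup₂ (f := fun U (_ : IsFiniteOpenCover U) =>
    amenableCondEntropy F U {(Set.univ : Set X)}) U hU)
  by_contra! hneg
  obtain ⟨a, ha, ha0⟩ := EReal.lt_iff_exists_real_btwn.mp hneg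
  obtain ⟨n, M, code, hcode, -, hM⟩ :=
    (eventually_exists_code_of_amenableCondEntropy_lt hF hUP ha).exists
  have ha0' : a < 0 := by exact_mod_cast ha0
  have hpos : (0 : ℝ) < (F n).card := by exact_mod_cast Finset.card_pos.mpr (hF.nonempty n)
  have h1 : (M : ℝ) < 1 := hM.trans_lt (Real.exp_lt_one_iff.mpr (mul_neg_of_neg_of_pos ha0' hpos))
  have h2 : M = 0 := by
    have : M < 1 := by exact_mod_cast h1
    omega
  have := hcode 1
  omega

theorem amenableTopEntropy_lt_top_of_isAsymptoticallyHExpansive (S : SoficApproximation G)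
    {F : ℕ → Finset G} (hF : IsFolnerSequence F) (h : IsAsymptoticallyHExpansive S X) :
    amenableTopEntropy F X < ⊤ := by
  have h0 : soficTailEntropy S X < (1 : ℝ) := lt_of_le_of_lt h (by exact_mod_cast zero_lt_one)
  simp only [soficTailEntropy, iInf_lt_iff] at h0
  obtain ⟨U₂, hU₂, h2⟩ := h0
  have hm : 0 < U₂.ncard := by
    rw [Set.ncard_pos hU₂.finite]
    obtain ⟨u, hu, -⟩ : (1 : X) ∈ ⋃₀ U₂ := hU₂.sUnion_eq ▸ Set.mem_univ _
    exact ⟨u, hu⟩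
  -- One unit is the bound on the conditional entropy, the other is the loss `c = 1` in the lower
  -- bound for separated sets.
  refine lt_of_le_of_lt (b := ((Real.log U₂.ncard + 2 : ℝ) : EReal)) (iSup₂_le fun U hU => ?_)
    (EReal.coe_lt_top _)
  by_contra! hlt
  obtain ⟨a, ha, haU⟩ := EReal.lt_iff_exists_real_btwn.mp hlt
  have ha' : Real.log U₂.ncard + 2 < a := by exact_mod_cast ha
  obtain ⟨P, hP, hPinv, hPU⟩ := hU.exists_lebesgue_nhds
  obtain ⟨U₁, hU₁, hU₁P⟩ := exists_small_cover hP
  have h3 : soficCondEntropy S U₁ U₂ < (1 : ℝ) := lt_of_le_of_lt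
    (le_iSup₂ (f := fun U₁ (_ : IsFiniteOpenCover U₁) => soficCondEntropy S U₁ U₂) U₁ hU₁) h2
  simp only [soficCondEntropy, iInf_lt_iff] at h3
  obtain ⟨K, -, δ, hδ, h4⟩ := h3
  have h5 := eventually_exists_separated S hF hP
    (frequently_exists_separated_of_lt_amenableCondEntropy hF (mem_of_mem_nhds hP) hPinv hPU haU)
    one_pos K hδ
  obtain ⟨i, hi, E, hEK, hE, hEcard⟩ :=
    ((eventually_lt_of_limsup_lt h4 (by isBoundedDefault)).and h5).exists
  obtain ⟨M, hM, hMexp⟩ := exists_le_exp_of_logCard_div_lt (S.d_pos i) hi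
  have h6 := card_le_of_coverNumber_le hU₁P hU₂.finite hU₂.sUnion_eq (fun V hV =>
    (le_iSup₂ (f := fun V (_ : V ∈ powerCover U₂ (S.d i)) =>
      coverNumber (powerCover U₁ (S.d i)) (almostEquivariant K δ (S.σ i) ∩ V)) V hV).trans hM.le)
    hEK hE
  have hd : (0 : ℝ) < S.d i := by exact_mod_cast S.d_pos i
  have h7 : (E.card : ℝ) ≤ (U₂.ncard : ℝ) ^ S.d i * M := by exact_mod_cast h6
  have h8 : (U₂.ncard : ℝ) ^ S.d i = Real.exp (Real.log U₂.ncard * S.d i) := by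
    rw [← Real.rpow_natCast, Real.rpow_def_of_pos (by exact_mod_cast hm)]
  rw [h8] at h7
  have h9 := hEcard.trans (h7.trans (mul_le_mul_of_nonneg_left hMexp (Real.exp_pos _).le))
  rw [← Real.exp_add, Real.exp_le_exp, ← add_mul] at h9
  have := le_of_mul_le_mul_right h9 hd
  linarith

theorem isAsymptoticallyHExpansive_of_amenableTopEntropy_lt_top (S : SoficApproximation G)
    {F : ℕ → Finset G} (hF : IsFolnerSequence F) (h : amenableTopEntropy F X < ⊤) :
    IsAsymptoticallyHExpansive S X := by
  have h0 : 0 ≤ amenableTopEntropy F X := zero_le_amenableTopEntropy hF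
  obtain ⟨e, he⟩ : ∃ e : ℝ, amenableTopEntropy F X = e :=
    ⟨_, (EReal.coe_toReal h.ne (ne_bot_of_le_ne_bot (by simp) h0)).symm⟩
  have he0 : 0 ≤ e := by
    rw [he] at h0
    exact_mod_cast h0
  rw [IsAsymptoticallyHExpansive]
  by_contra! hpos
  obtain ⟨b, hb0, hb⟩ := EReal.lt_iff_exists_real_btwn.mp hpos
  have hb0' : 0 < b := by exact_mod_cast hb0
  refine not_le.mpr hb ?_
  -- The rate is at least `e - 2c` for `E` and at most `e + 2c` for the products, leaving `4c = b`
  -- for `Q`.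
  set c := b / 4 with hc
  have hc0 : 0 < c := by positivity
  have hlt : ((e - c : ℝ) : EReal) < amenableTopEntropy F X := by
    rw [he]
    exact_mod_cast sub_lt_self e hc0
  simp only [amenableTopEntropy, amenableEntropyGiven, lt_iSup_iff] at hlt
  obtain ⟨U, hU, haU⟩ := hlt
  obtain ⟨O, hO, hOinv, hOU⟩ := hU.exists_lebesgue_nhds
  have hlower := frequently_exists_separated_of_lt_amenableCondEntropy hF
    (mem_of_mem_nhds hO) hOinv hOU haU
  obtain ⟨O', hO', hO'inv, hO'O⟩ := exists_symm_nhds_one_mul_mul hO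
  -- `U₂` depends only on the scale `O` at which the entropy is nearly attained, so it serves every
  -- `U₁`.
  obtain ⟨U₂, hU₂, hU₂O'⟩ := exists_small_cover hO'
  refine iInf₂_le_of_le U₂ hU₂ (iSup₂_le fun U₁ hU₁ => ?_)
  obtain ⟨P₁, hP₁, hP₁inv, hP₁U⟩ := hU₁.exists_lebesgue_nhds
  -- `P₁` lets separated sets control covers by `U₁`; `O'` ensures that closeness of two products
  -- forces `O`-closeness of their factors from `E`.
  have hP : P₁ ∩ O' ∈ 𝓝 (1 : X) := Filter.inter_mem hP₁ hO'
  obtain ⟨P', hP', -, hPP⟩ := exists_symm_nhds_one_mul_mul hP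
  obtain ⟨U', hU', hU'P'⟩ := exists_small_cover hP'
  have hU'e : amenableCondEntropy F U' {Set.univ} < ((e + c : ℝ) : EReal) := by
    refine lt_of_le_of_lt (le_iSup₂ (f := fun U (_ : IsFiniteOpenCover U) =>
      amenableCondEntropy F U {(Set.univ : Set X)}) U' hU') ?_
    rw [show (⨆ U, ⨆ (_ : IsFiniteOpenCover U), amenableCondEntropy F U {(Set.univ : Set X)}) = e
      from he]
    exact_mod_cast lt_add_of_pos_right e hc0
  obtain ⟨K, hK, δ, hδ, hupper⟩ := eventually_card_separated_le S hF hP hP' hPP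
    (by positivity) (eventually_exists_code_of_amenableCondEntropy_lt hF hU'P' hU'e).frequently hc0
  obtain ⟨δ', hδ', hmul⟩ := exists_forall_mul_inv_mul_mem_almostEquivariant (G := G) (X := X) hδ
  refine iInf₂_le_of_le K hK (iInf₂_le_of_le δ' hδ' ?_)
  refine limsup_le_of_le (by isBoundedDefault) ?_
  filter_upwards [eventually_exists_separated S hF hO hlower hc0 K hδ', hupper]
    with i ⟨E, hEK, hE, hEcard⟩ hup
  refine logCard_div_le (S.d_pos i) (M := ⌊Real.exp (b * S.d i)⌋₊) (iSup₂_le ?_)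
    (Nat.floor_le (Real.exp_pos _).le)
  rintro _ ⟨u, hu, rfl⟩
  refine coverNumber_le_of_separated (R := fun x y => ∀ j, (x j)⁻¹ * y j ∈ P₁ ∩ O') ?_ ?_ ?_
    fun Q hQ hQsep => Nat.le_floor ?_
  · intro y j
    simpa using mem_of_mem_nhds hP
  · intro y z hyz j
    have := hyz j
    simpa using And.intro (hP₁inv _ this.1) (hO'inv _ this.2)
  · intro y
    choose v hvU hv using hP₁U
    refine ⟨Set.pi Set.univ fun j => v (y j), ⟨fun j => v (y j), fun j => hvU _, rfl⟩,
      fun z hz j _ => ?_⟩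
    simpa using hv (y j) _ (hz j).1
  · have h1 := card_mul_card_le (mem_of_mem_nhds hP)
      (fun p hp q hq r hr => hO'O p hp q hq.2 _ (hO'inv r hr))
      (hmul (S.d i) (S.d_pos i) K (S.σ i)) (Real.exp_pos _).le hup hEK hE
      (fun y hy => (hQ hy).1) (fun x hx y hy hxy => by simpa using hQsep x hx y hy hxy)
      (fun x hx y hy j => hU₂O' _ (hu j) _ ((hQ hx).2 j (Set.mem_univ j)) _
        ((hQ hy).2 j (Set.mem_univ j)))
    have h2 := (mul_le_mul_of_nonneg_right hEcard (Nat.cast_nonneg Q.card)).trans h1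
    refine le_of_mul_le_mul_left (h2.trans_eq ?_) (Real.exp_pos ((e - c - c) * S.d i))
    rw [← Real.exp_add, hc]
    ring_nf

end Main

end AlgAction

theorem theorem1307122130 {G X : Type*} [Group G] [Countable G]
    [MetricSpace X] [CompactSpace X] [Group X] [IsTopologicalGroup X]
    [MulDistribMulAction G X] [ContinuousConstSMul G X]
    (S : AlgAction.SoficApproximation G)
    (F : ℕ → Finset G) (hF : AlgAction.IsFolnerSequence F) :
    AlgAction.IsAsymptoticallyHExpansive S X ↔ AlgAction.amenableTopEntropy F X < ⊤ :=
  ⟨AlgAction.amenableTopEntropy_lt_top_of_isAsymptoticallyHExpansive S hF,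
    AlgAction.isAsymptoticallyHExpansive_of_amenableTopEntropy_lt_top S hF⟩
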